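/- Let $r\ge 3$ be an integer, let $H:\mathbb R^2\to\mathbb R$ be $C^{r+1}$, and let $f=(H_{x_2},-H_{x_1})$. Let $V\subset\mathbb R$ be an open interval, and let $q:\mathbb R\times V\to\mathbb R^2$ be a $C^r$ map such that for every $h\in V$ the function $q(\cdot,h)$ is a nonconstant periodic solution of $\dot x=f(x)$ with least period $T(h)>0$ and $H(q(t,h))=h$ for all $t$. Let $L_h=\{q(t,h):t\in\mathbb R\}$ be the corresponding closed orbit and $\Omega(h)=2\pi/T(h)$. Consider the impulsive system $$\dot x=f(x)+\varepsilon g(t,x,\varepsilon)\quad(t\ne t_k),\qquad x(t_k+)-x(t_k-)=\varepsilon\, l_k(x(t_k-),\varepsilon)\quad(k\in\mathbb Z),\tag{3}$$ where - $g:\mathbb R\times\mathbb R^2\times\mathbb R\to\mathbb R^2$ is $C^r$ and periodic in $t$ with period $T_1>0$; - $(t_k)_{k\in\mathbb Z}$ is strictly increasing with $t_k\to\pm\infty$ as $k\to\pm\infty$; - each $l_k:\mathbb R^2\times\mathbb R\to\mathbb R^2$ is $C^r$ in $x$ for each fixed $\varepsilon$ and continuous in $(x,\varepsilon)$; - there are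 $T_2>0$ and an integer $n\ge1$ with $t_{k+n}-t_k=T_2$ and $l_{k+n}=l_k$ for all $k$; - $T_2/T_1=p/s$ with coprime integers $p,s\ge1$. Put $T=pT_1=sT_2$, and let $h_0\in V$ satisfy $T(h_0)/T=m/K$ with coprime integers $m,K\ge1$. Solutions of (3) are continuous from the left at the times $t_k$. A solution of (3) defined on all of $\mathbb R$ with period $mT$ is called harmonic if $m=1$ and subharmonic of order $m$ if $m>1$. Define $$M(\tau,r)=\int_{\tau}^{\tau+mT}DH(q(t-\tau,r))\,g(t,q(t-\tau,r),0)\,dt+\sum_{k:\ \tau\le t_k<\tau+mT}DH(q(t_k-\tau,r))\,l_k(q(t_k-\tau,r),0).$$ (1) Suppose $L_{h_0}$ generates harmonic (subharmonic of order $m$) solutions, in the sense that for every $\delta>0$ there are $\varepsilon$ with $0<|\varepsilon|<\delta$ and an $mT$-periodic solution of (3) all of whose values lie at distance less than $\delta$ from $L_{h_0}$. Then there is $t_0^*\in[0,T]$ with $M(t_0^*,h_0)=0$. (2) Let $t_0^*\in[0,T]$ satisfy $M(t_0^*,h_0)=0$, and suppose that $\Omega'(h_0)\ne0$ and $\dfrac{\partial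 M}{\partial \tau}(t_0^*,h_0)\neq 0$ (derivative in the first argument). Then there are $\varepsilon_0>0$ and, for every $\varepsilon$ with $0<|\varepsilon|<\varepsilon_0$, a harmonic ($m=1$) or subharmonic of order $m$ ($m>1$) solution $x_\varepsilon$ of (3) such that $x_\varepsilon(t)\to q(t-t_0^*,h_0)$ as $\varepsilon\to0$, uniformly in $t\in\mathbb R$. -/

import Mathlib

open Set Filter Topology

noncomputable section

/-- The plane `ℝ²`. -/
abbrev Plane : Type := EuclideanSpace ℝ (Fin 2)

/-- The Hamiltonian vector field `f(x) = (H_{x₂}(x), -H_{x₁}(x))`. -/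
def hamiltonianField (H : Plane → ℝ) (x : Plane) : Plane :=
  !₂[fderiv ℝ H x (EuclideanSpace.single 1 1), -fderiv ℝ H x (EuclideanSpace.single 0 1)]

/-- `q(·, h)`, `h ∈ V`, is a family (of class `C^r` in `(t, h)`) of nonconstant periodic solutions of
the Hamiltonian system with Hamiltonian `H`, lying on the level curves `H = h`, and
`per h > 0` is the (least) period of `q(·, h)`. -/
structure IsPeriodicFamily (r : ℕ) (H : Plane → ℝ) (V : Set ℝ)
    (q : ℝ → ℝ → Plane) (per : ℝ → ℝ) : Prop where
  contDiffOn : ContDiffOn ℝ r (fun z : ℝ × ℝ => q z.1 z.2) (univ ×ˢ V)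
  level : ∀ h ∈ V, ∀ t, H (q t h) = h
  ode : ∀ h ∈ V, ∀ t, HasDerivAt (fun u => q u h) (hamiltonianField H (q t h)) t
  per_pos : ∀ h ∈ V, 0 < per h
  periodic : ∀ h ∈ V, Function.Periodic (fun t => q t h) (per h)
  least : ∀ h ∈ V, ∀ u, 0 < u → u < per h → q u h ≠ q 0 h

/-- The closed orbit `L_h`. -/
def closedOrbit (q : ℝ → ℝ → Plane) (h : ℝ) : Set Plane :=
  range fun t => q t h

/-- The frequency `Ω(h) = 2π / T(h)`. -/
def frequency (per : ℝ → ℝ) (h : ℝ) : ℝ :=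
  2 * Real.pi / per h

/-- `x : ℝ → ℝ²` is a solution on the whole line of the impulsive system
`x' = f(x) + ε g(t, x, ε)` for `t ≠ t_k`, `x(t_k+) - x(t_k-) = ε l_k(x(t_k-), ε)`.
Solutions are continuous from the left at the impulse times, so `x(t_k-) = x(t_k)`. -/
structure IsImpulsiveSolution (H : Plane → ℝ) (g : ℝ → Plane → ℝ → Plane) (t : ℤ → ℝ)
    (l : ℤ → Plane → ℝ → Plane) (ε : ℝ) (x : ℝ → Plane) : Prop where
  ode : ∀ u, u ∉ range t → HasDerivAt x (hamiltonianField H (x u) + ε • g u (x u) ε) u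
  left_cont : ∀ k, Tendsto x (𝓝[<] (t k)) (𝓝 (x (t k)))
  jump : ∀ k, Tendsto x (𝓝[>] (t k)) (𝓝 (x (t k) + ε • l k (x (t k)) ε))

/-- A solution of the impulsive system of period `m T`: a harmonic solution if `m = 1`, and a
subharmonic solution of order `m` if `m > 1`. -/
structure IsSubharmonicSolution (H : Plane → ℝ) (g : ℝ → Plane → ℝ → Plane) (t : ℤ → ℝ)
    (l : ℤ → Plane → ℝ → Plane) (T : ℝ) (m : ℕ) (ε : ℝ) (x : ℝ → Plane) : Prop where
  solution : IsImpulsiveSolution H g t l ε x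
  periodic : Function.Periodic x (m * T)

/-- The set `L` generates (harmonic or) subharmonic solutions of order `m`: for arbitrarily small
`ε ≠ 0` the impulsive system has such a solution staying arbitrarily close to `L`. -/
def GeneratesSubharmonic (H : Plane → ℝ) (g : ℝ → Plane → ℝ → Plane) (t : ℤ → ℝ)
    (l : ℤ → Plane → ℝ → Plane) (T : ℝ) (m : ℕ) (L : Set Plane) : Prop :=
  ∀ δ > 0, ∃ ε x, 0 < |ε| ∧ |ε| < δ ∧ IsSubharmonicSolution H g t l T m ε x ∧
    ∀ u, Metric.infDist (x u) L < δ

/-- The Melnikov function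
`M(τ, r) = ∫_τ^{τ+mT} DH(q(s-τ,r)) g(s, q(s-τ,r), 0) ds
  + ∑ DH(q(t_k-τ,r)) l_k(q(t_k-τ,r), 0)`,
where the (finite) sum runs over the impulses `τ ≤ t_k < τ + mT`; if `t_{j-1} < τ ≤ t_j`, these are
`k = j, …, j + n - 1` with `n` the number of impulses in a time interval of length `mT`. -/
def melnikov (H : Plane → ℝ) (g : ℝ → Plane → ℝ → Plane) (t : ℤ → ℝ)
    (l : ℤ → Plane → ℝ → Plane) (q : ℝ → ℝ → Plane) (T : ℝ) (m : ℕ) (τ r : ℝ) : ℝ :=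
  (∫ s in τ..(τ + m * T), fderiv ℝ H (q (s - τ) r) (g s (q (s - τ) r) 0)) +
    ∑ᶠ k ∈ {k : ℤ | τ ≤ t k ∧ t k < τ + m * T},
      fderiv ℝ H (q (t k - τ) r) (l k (q (t k - τ) r) 0)

end

/-!
The Melnikov function is the first-order energy change over a period. Along a solution of the
impulsive system, `H` changes only through the perturbation, because `DH(f) = 0`; if the solution
converges, as `ε → 0`, to the translate `y = q(· - σ, h)` of an orbit, the change of `H` over the
window `[t 0, t 0 + m T]` is `ε` times `energyIntegral` of `y`, up to `o(ε)`
(`tendsto_energy_chain`). On the resonant orbit `h₀` the integrand and the impulses are periodic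
along the window, so this integral equals `melnikov σ h₀` (`melnikov_eq_energyIntegral`), and it is
`T`-periodic in `σ` (`melnikov_periodic`).

*Necessity.* Periodic solutions have no energy change. If they approach `L_{h₀}`, their initial
values accumulate at a point of the orbit, and in the limit the Melnikov function vanishes
(`exists_energyIntegral_eq_zero`).

*Sufficiency.* A solution starting at `q(t 0 - σ, h)` closes up after `m T` as soon as its energy
and its component along the flow direction return (`exists_nhds_eq_of_energy_of_phase`). For
`(σ, h)` in a small rectangle around `(τ, h₀)` and small `ε`, the energy difference divided by `ε`
is close to the Melnikov function, which changes sign at `τ`, and the phase difference is close to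
the drift caused by `Ω h ≠ Ω h₀`, which changes sign at `h₀`. The impulses `l_k` are smooth in `x`
for each `ε` but merely continuous in `ε`, so the implicit function theorem is not available;
instead, the Poincaré–Miranda theorem (`poincare_miranda`) gives a common zero
(`eventually_exists_periodic_near`). It is proved with a continuous logarithm on the plane.

Only a neighbourhood of a compact set of orbits matters, so `H` and `g` are multiplied by cut-off
functions; the equation between impulses then has a bounded Lipschitz right-hand side, global
solutions, and Grönwall estimates. A trajectory over a period is handled as a finite chain of
smooth pieces on the closed intervals between impulses (`IsImpulsiveChain`).
-/

open scoped NNReal RealInnerProductSpace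

/-! ### The Poincaré–Miranda theorem in the plane -/

/-- If `cos ∘ θ` is positive along a connected set, then the angle `θ` increases from a point with
negative sine to a point with positive sine. -/
lemma angle_lt_of_cos_pos {X : Type*} [TopologicalSpace X] {S : Set X} (hS : IsPreconnected S)
    {θ : X → ℝ} (hθ : ContinuousOn θ S) (hcos : ∀ x ∈ S, 0 < Real.cos (θ x)) {P Q : X}
    (hP : P ∈ S) (hQ : Q ∈ S) (hsP : Real.sin (θ P) < 0) (hsQ : 0 < Real.sin (θ Q)) :
    θ P < θ Q := by
  by_contra! hle
  have hsub : Icc (θ Q) (θ P) ⊆ θ '' S :=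
    (hS.image θ hθ).ordConnected.out (mem_image_of_mem θ hQ) (mem_image_of_mem θ hP)
  have hmono : MonotoneOn Real.sin (Icc (θ Q) (θ P)) := by
    refine monotoneOn_of_deriv_nonneg (convex_Icc _ _) Real.continuous_sin.continuousOn
      Real.differentiable_sin.differentiableOn fun a ha => ?_
    obtain ⟨x, hx, rfl⟩ := hsub (interior_subset ha)
    simpa using (hcos x hx).le
  have := hmono (left_mem_Icc.2 hle) (right_mem_Icc.2 hle) hle
  linarith

/-- The **Poincaré–Miranda theorem** in the plane. If `(u, v)` had no zero, it would have a
continuous argument on the whole rectangle, which would increase along each of the four edges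
traversed counterclockwise. -/
theorem poincare_miranda {a₁ a₂ b₁ b₂ : ℝ} (ha : a₁ ≤ a₂) (hb : b₁ ≤ b₂) {u v : ℝ × ℝ → ℝ}
    (hu : ContinuousOn u (Icc a₁ a₂ ×ˢ Icc b₁ b₂)) (hv : ContinuousOn v (Icc a₁ a₂ ×ˢ Icc b₁ b₂))
    (hu₁ : ∀ y ∈ Icc b₁ b₂, u (a₁, y) < 0) (hu₂ : ∀ y ∈ Icc b₁ b₂, 0 < u (a₂, y))
    (hv₁ : ∀ x ∈ Icc a₁ a₂, v (x, b₁) < 0) (hv₂ : ∀ x ∈ Icc a₁ a₂, 0 < v (x, b₂)) :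
    ∃ z ∈ Icc a₁ a₂ ×ˢ Icc b₁ b₂, u z = 0 ∧ v z = 0 := by
  by_contra! hne
  -- extend to the plane by the retraction onto the rectangle
  set π : ℝ × ℝ → ℝ × ℝ := fun z => (projIcc a₁ a₂ ha z.1, projIcc b₁ b₂ hb z.2) with hπ
  have hπc : Continuous π := by
    have h1 : Continuous fun z : ℝ × ℝ => projIcc a₁ a₂ ha z.1 :=
      continuous_projIcc.comp continuous_fst
    have h2 : Continuous fun z : ℝ × ℝ => projIcc b₁ b₂ hb z.2 :=
      continuous_projIcc.comp continuous_snd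
    exact (continuous_subtype_val.comp h1).prodMk (continuous_subtype_val.comp h2)
  have hπm : ∀ z, π z ∈ Icc a₁ a₂ ×ˢ Icc b₁ b₂ := fun z => ⟨Subtype.prop _, Subtype.prop _⟩
  have hπid : ∀ z ∈ Icc a₁ a₂ ×ˢ Icc b₁ b₂, π z = z := by
    rintro ⟨x, y⟩ ⟨hx, hy⟩
    simp only [hπ, projIcc_of_mem ha hx, projIcc_of_mem hb hy]
  have huc : Continuous fun z => u (π z) := hu.comp_continuous hπc hπm
  have hvc : Continuous fun z => v (π z) := hv.comp_continuous hπc hπm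
  set G : ℝ × ℝ → ℂ := fun z => ⟨u (π z), v (π z)⟩ with hG
  have hGc : Continuous G := by
    have : G = fun z => ((u (π z) : ℂ) + (v (π z) : ℂ) * Complex.I) := by
      ext z; simp [hG, Complex.mk_eq_add_mul_I]
    rw [this]
    exact (Complex.continuous_ofReal.comp huc).add
      ((Complex.continuous_ofReal.comp hvc).mul continuous_const)
  have hG0 : ∀ z, G z ≠ 0 := fun z h => by
    have h1 : u (π z) = 0 := congrArg Complex.re h
    have h2 : v (π z) = 0 := congrArg Complex.im h
    exact hne _ (hπm z) h1 h2
  have hconv : IsSimplyConnected (univ : Set (ℝ × ℝ)) := by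
    have : ContractibleSpace (univ : Set (ℝ × ℝ)) := convex_univ.contractibleSpace univ_nonempty
    exact SimplyConnectedSpace.ofContractible _
  obtain ⟨φ, hφc, hφ⟩ := Complex.exists_continuousOn_eqOn_exp_comp hconv isOpen_univ
    hGc.continuousOn (by rintro ⟨z, -, hz⟩; exact hG0 z hz)
  set θ : ℝ × ℝ → ℝ := fun z => (φ z).im with hθ
  have hθc : Continuous θ := Complex.continuous_im.comp (continuousOn_univ.1 hφc)
  have hre : ∀ z ∈ Icc a₁ a₂ ×ˢ Icc b₁ b₂, u z = Real.exp (φ z).re * Real.cos (θ z) := by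
    intro z hz
    have h := congrArg Complex.re (hφ (mem_univ z))
    simp only [Function.comp, Complex.exp_re, hG, hπid z hz] at h
    exact h.symm
  have him : ∀ z ∈ Icc a₁ a₂ ×ˢ Icc b₁ b₂, v z = Real.exp (φ z).re * Real.sin (θ z) := by
    intro z hz
    have h := congrArg Complex.im (hφ (mem_univ z))
    simp only [Function.comp, Complex.exp_im, hG, hπid z hz] at h
    exact h.symm
  have hla := left_mem_Icc.2 ha
  have hra := right_mem_Icc.2 ha
  have hlb := left_mem_Icc.2 hb
  have hrb := right_mem_Icc.2 hb
  have cpos : ∀ z ∈ Icc a₁ a₂ ×ˢ Icc b₁ b₂, 0 < u z → 0 < Real.cos (θ z) := fun z hz h => by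
    rw [hre z hz] at h; exact (pos_iff_pos_of_mul_pos h).1 (Real.exp_pos _)
  have cneg : ∀ z ∈ Icc a₁ a₂ ×ˢ Icc b₁ b₂, u z < 0 → Real.cos (θ z) < 0 := fun z hz h => by
    rw [hre z hz] at h; exact neg_of_mul_neg_right h (Real.exp_pos _).le
  have spos : ∀ z ∈ Icc a₁ a₂ ×ˢ Icc b₁ b₂, 0 < v z → 0 < Real.sin (θ z) := fun z hz h => by
    rw [him z hz] at h; exact (pos_iff_pos_of_mul_pos h).1 (Real.exp_pos _)
  have sneg : ∀ z ∈ Icc a₁ a₂ ×ˢ Icc b₁ b₂, v z < 0 → Real.sin (θ z) < 0 := fun z hz h => by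
    rw [him z hz] at h; exact neg_of_mul_neg_right h (Real.exp_pos _).le
  have edgev : ∀ x, IsPreconnected (({x} : Set ℝ) ×ˢ Icc b₁ b₂) := fun x =>
    isPreconnected_singleton.prod isPreconnected_Icc
  have edgeh : ∀ y, IsPreconnected (Icc a₁ a₂ ×ˢ ({y} : Set ℝ)) := fun y =>
    isPreconnected_Icc.prod isPreconnected_singleton
  have right : θ (a₂, b₁) < θ (a₂, b₂) := by
    refine angle_lt_of_cos_pos (edgev a₂) hθc.continuousOn ?_ ⟨rfl, hlb⟩ ⟨rfl, hrb⟩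
      (sneg _ ⟨hra, hlb⟩ (hv₁ _ hra)) (spos _ ⟨hra, hrb⟩ (hv₂ _ hra))
    rintro ⟨x, y⟩ ⟨hx, hy⟩
    obtain rfl : x = a₂ := hx
    exact cpos _ ⟨hra, hy⟩ (hu₂ y hy)
  have top : θ (a₂, b₂) < θ (a₁, b₂) := by
    have := angle_lt_of_cos_pos (θ := fun z => θ z - Real.pi / 2) (edgeh b₂)
      (hθc.sub continuous_const).continuousOn ?_ (P := (a₂, b₂)) (Q := (a₁, b₂)) ⟨hra, rfl⟩
      ⟨hla, rfl⟩ ?_ ?_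
    · simpa using this
    · rintro ⟨x, y⟩ ⟨hx, hy⟩
      obtain rfl : y = b₂ := hy
      rw [Real.cos_sub_pi_div_two]
      exact spos _ ⟨hx, hrb⟩ (hv₂ x hx)
    · rw [Real.sin_sub_pi_div_two]
      linarith [cpos _ ⟨hra, hrb⟩ (hu₂ _ hrb)]
    · rw [Real.sin_sub_pi_div_two]
      linarith [cneg _ ⟨hla, hrb⟩ (hu₁ _ hrb)]
  have left : θ (a₁, b₂) < θ (a₁, b₁) := by
    have := angle_lt_of_cos_pos (θ := fun z => θ z - Real.pi) (edgev a₁)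
      (hθc.sub continuous_const).continuousOn ?_ (P := (a₁, b₂)) (Q := (a₁, b₁)) ⟨rfl, hrb⟩
      ⟨rfl, hlb⟩ ?_ ?_
    · simpa using this
    · rintro ⟨x, y⟩ ⟨hx, hy⟩
      obtain rfl : x = a₁ := hx
      rw [Real.cos_sub_pi]
      linarith [cneg _ ⟨hla, hy⟩ (hu₁ y hy)]
    · rw [Real.sin_sub_pi]
      linarith [spos _ ⟨hla, hrb⟩ (hv₂ _ hla)]
    · rw [Real.sin_sub_pi]
      linarith [sneg _ ⟨hla, hlb⟩ (hv₁ _ hla)]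
  have bottom : θ (a₁, b₁) < θ (a₂, b₁) := by
    have := angle_lt_of_cos_pos (θ := fun z => θ z + Real.pi / 2) (edgeh b₁)
      (hθc.add continuous_const).continuousOn ?_ (P := (a₁, b₁)) (Q := (a₂, b₁)) ⟨hla, rfl⟩
      ⟨hra, rfl⟩ ?_ ?_
    · simpa using this
    · rintro ⟨x, y⟩ ⟨hx, hy⟩
      obtain rfl : y = b₁ := hy
      rw [Real.cos_add_pi_div_two]
      linarith [sneg _ ⟨hx, hlb⟩ (hv₁ x hx)]
    · rw [Real.sin_add_pi_div_two]
      exact cneg _ ⟨hla, hlb⟩ (hu₁ _ hlb)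
    · rw [Real.sin_add_pi_div_two]
      exact cpos _ ⟨hra, hlb⟩ (hu₂ _ hlb)
  linarith

/-! ### Solutions of differential equations on compact intervals -/

section ODE
variable {E : Type*} [NormedAddCommGroup E] [NormedSpace ℝ E]

/-- `x` solves `x' = F(u, x)` in the open interval `(a, b)` and is continuous up to the endpoints. -/
structure IsArc (F : ℝ → E → E) (a b : ℝ) (x : ℝ → E) : Prop where
  continuousOn : ContinuousOn x (Icc a b)
  hasDerivAt : ∀ u ∈ Ioo a b, HasDerivAt x (F u (x u)) u

lemma IsArc.hasDerivWithinAt_Ici {F : ℝ → E → E} {a b : ℝ} {x : ℝ → E} (hx : IsArc F a b x)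
    (hF : Continuous (Function.uncurry F)) {u : ℝ} (hu : u ∈ Ico a b) :
    HasDerivWithinAt x (F u (x u)) (Ici u) u := by
  rcases hu.1.eq_or_lt with rfl | hau
  · have hab : a < b := hu.2
    have hmem : Ioo a b ∈ 𝓝[>] a := Ioo_mem_nhdsGT hab
    have hxa : ContinuousWithinAt x (Ioo a b) a :=
      (hx.continuousOn a (left_mem_Icc.2 hab.le)).mono Ioo_subset_Icc_self
    refine hasDerivWithinAt_Ici_of_tendsto_deriv (s := Ioo a b)
      (fun u hu => (hx.hasDerivAt u hu).differentiableAt.differentiableWithinAt) hxa hmem ?_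
    have h1 : Tendsto (fun u => F u (x u)) (𝓝[Ioo a b] a) (𝓝 (F a (x a))) :=
      (hF.tendsto (a, x a)).comp ((continuousWithinAt_id.prodMk hxa :
        ContinuousWithinAt (fun u => (u, x u)) (Ioo a b) a))
    rw [nhdsWithin_Ioo_eq_nhdsGT hab] at h1
    refine h1.congr' ?_
    filter_upwards [hmem] with u hu using (hx.hasDerivAt u hu).deriv.symm
  · exact (hx.hasDerivAt u ⟨hau, hu.2⟩).hasDerivWithinAt

/-- A bounded, uniformly Lipschitz vector field has solutions on every compact interval. -/
lemma exists_isArc [CompleteSpace E] {F : ℝ → E → E} (hF : Continuous (Function.uncurry F))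
    {C : ℝ≥0} (hL : ∀ u, LipschitzWith C (F u)) {B : ℝ≥0} (hB : ∀ u x, ‖F u x‖ ≤ B)
    {a b : ℝ} (hab : a ≤ b) (x₀ : E) : ∃ x, x a = x₀ ∧ IsArc F a b x := by
  have hba : 0 ≤ b - a := sub_nonneg.2 hab
  have hpl : IsPicardLindelof F (⟨a, left_mem_Icc.2 hab⟩ : Icc a b) x₀ (B * ⟨b - a, hba⟩) 0 B C :=
    { lipschitzOnWith := fun t _ => (hL t).lipschitzOnWith
      continuousOn := fun x _ => (hF.comp (by fun_prop : Continuous fun u : ℝ => (u, x))).continuousOn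
      norm_le := fun t _ x _ => hB t x
      mul_max_le := by
        simp [hba]
        exact le_of_eq rfl }
  obtain ⟨x, hxa, hx⟩ := hpl.exists_eq_forall_mem_Icc_hasDerivWithinAt₀
  exact ⟨x, hxa, fun u hu => (hx u hu).continuousWithinAt,
    fun u hu => (hx u (Ioo_subset_Icc_self hu)).hasDerivAt (Icc_mem_nhds hu.1 hu.2)⟩

lemma IsArc.dist_le {F : ℝ → E → E} (hF : Continuous (Function.uncurry F))
    {C : ℝ≥0} (hL : ∀ u, LipschitzWith C (F u)) {F' : ℝ → E → E}
    (hF' : Continuous (Function.uncurry F')) {η : ℝ} (hη : ∀ u z, dist (F' u z) (F u z) ≤ η)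
    {a b : ℝ} {x y : ℝ → E} (hx : IsArc F' a b x) (hy : IsArc F a b y) :
    ∀ u ∈ Icc a b, dist (x u) (y u) ≤ gronwallBound (dist (x a) (y a)) C η (u - a) := by
  have := dist_le_of_approx_trajectories_ODE (v := F) (K := C) hL hx.continuousOn
    (fun t ht => hx.hasDerivWithinAt_Ici hF' ht) (fun t _ => hη t (x t)) hy.continuousOn
    (fun t ht => hy.hasDerivWithinAt_Ici hF ht) (fun t _ => (dist_self _).le) le_rfl
  simpa using this

/-- `gronwallBound δ K η` vanishes continuously with `(δ, η)`. -/
lemma tendsto_gronwallBound_zero {ι : Type*} {lf : Filter ι} {δ η : ι → ℝ}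
    (hδ : Tendsto δ lf (𝓝 0)) (hη : Tendsto η lf (𝓝 0)) (K x : ℝ) :
    Tendsto (fun i => gronwallBound (δ i) K (η i) x) lf (𝓝 0) := by
  by_cases hK : K = 0
  · subst hK
    simp only [gronwallBound_K0]
    simpa using hδ.add (hη.mul_const x)
  · simp only [gronwallBound_of_K_ne_0 hK]
    simpa using (hδ.mul_const (Real.exp (K * x))).add
      ((hη.div_const K).mul_const (Real.exp (K * x) - 1))

/-- Continuous dependence of solutions on the initial value and the vector field. -/
lemma tendstoUniformlyOn_of_isArc {F : ℝ → E → E} (hF : Continuous (Function.uncurry F))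
    {C : ℝ≥0} (hL : ∀ u, LipschitzWith C (F u)) {ι : Type*} {lf : Filter ι} {F' : ι → ℝ → E → E}
    (hF' : ∀ i, Continuous (Function.uncurry (F' i))) {η : ι → ℝ} (hη0 : ∀ i, 0 ≤ η i)
    (hη : ∀ i u z, dist (F' i u z) (F u z) ≤ η i)
    (hηlim : Tendsto η lf (𝓝 0)) {a b : ℝ} {x : ι → ℝ → E} {y : ℝ → E}
    (hx : ∀ᶠ i in lf, IsArc (F' i) a b (x i)) (hy : IsArc F a b y)
    (hlim : Tendsto (fun i => x i a) lf (𝓝 (y a))) :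
    TendstoUniformlyOn x y lf (Icc a b) := by
  rw [Metric.tendstoUniformlyOn_iff]
  intro δ hδ
  have h0 := tendsto_gronwallBound_zero (tendsto_iff_dist_tendsto_zero.1 hlim) hηlim C (b - a)
  filter_upwards [hx, h0.eventually (gt_mem_nhds hδ)] with i hi hlt u hu
  rw [dist_comm]
  refine (hi.dist_le hF hL (hF' i) (hη i) hy u hu).trans_lt (lt_of_le_of_lt ?_ hlt)
  exact gronwallBound_mono dist_nonneg (hη0 i) C.2 (by linarith [hu.2])

end ODE

/-! ### Cutting off the perturbed Hamiltonian system -/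

/-- A smooth compactly supported function equal to `1` on a prescribed ball. -/
lemma exists_contDiff_cutoff (E : Type*) [NormedAddCommGroup E] [NormedSpace ℝ E]
    [FiniteDimensional ℝ E] {R : ℝ} (hR : 0 < R) (n : ℕ) :
    ∃ χ : E → ℝ, ContDiff ℝ n χ ∧ HasCompactSupport χ ∧ ∀ x, ‖x‖ ≤ R → χ x = 1 := by
  let χ : ContDiffBump (0 : E) := ⟨R, R + 1, hR, by linarith⟩
  exact ⟨χ, χ.contDiff, χ.hasCompactSupport, fun x hx => χ.one_of_mem_closedBall (by simpa using hx)⟩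

lemma fderiv_hamiltonianField (H : Plane → ℝ) (x : Plane) :
    fderiv ℝ H x (hamiltonianField H x) = 0 := by
  have h : hamiltonianField H x =
      fderiv ℝ H x (EuclideanSpace.single 1 1) • EuclideanSpace.single (0 : Fin 2) (1 : ℝ) -
      fderiv ℝ H x (EuclideanSpace.single 0 1) • EuclideanSpace.single (1 : Fin 2) (1 : ℝ) := by
    ext i
    fin_cases i <;> simp [hamiltonianField]
  rw [h]
  simp only [map_sub, map_smul, smul_eq_mul]
  ring

lemma contDiff_hamiltonianField {H : Plane → ℝ} {n : ℕ} (hH : ContDiff ℝ (n + 1) H) :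
    ContDiff ℝ n (hamiltonianField H) := by
  have hd : ContDiff ℝ n (fderiv ℝ H) := hH.fderiv_right (m := n) le_rfl
  rw [contDiff_euclidean]
  intro i
  fin_cases i
  · simpa [hamiltonianField] using hd.clm_apply contDiff_const
  · simpa [hamiltonianField] using (hd.clm_apply contDiff_const).neg

lemma hasCompactSupport_hamiltonianField {H : Plane → ℝ} (hH : HasCompactSupport H) :
    HasCompactSupport (hamiltonianField H) := by
  refine (hH.fderiv ℝ).mono fun x hx => ?_
  contrapose! hx
  simp only [Function.mem_support, not_not] at hx ⊢
  ext i
  fin_cases i <;> simp [hamiltonianField, hx]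

/-- The right-hand side `f(x) + ε g(u, x, ε)` of the perturbed Hamiltonian system. -/
noncomputable def perturbedField (H : Plane → ℝ) (g : ℝ → Plane → ℝ → Plane) (ε u : ℝ)
    (x : Plane) : Plane :=
  hamiltonianField H x + ε • g u x ε

/-- Smooth data with compact support: the perturbed field is then bounded and Lipschitz. -/
structure IsCutoffSystem (H : Plane → ℝ) (g : ℝ → Plane → ℝ → Plane) : Prop where
  contDiff_ham : ContDiff ℝ 2 H
  compact_ham : HasCompactSupport H
  contDiff_pert : ContDiff ℝ 1 fun z : ℝ × Plane × ℝ => g z.1 z.2.1 z.2.2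
  compact_pert : HasCompactSupport fun z : ℝ × Plane × ℝ => g z.1 z.2.1 z.2.2

namespace IsCutoffSystem

variable {H : Plane → ℝ} {g : ℝ → Plane → ℝ → Plane}

lemma contDiff_field (hS : IsCutoffSystem H g) : ContDiff ℝ 1 (hamiltonianField H) := by
  have := contDiff_hamiltonianField (n := 1) (H := H)
    (by simpa [one_add_one_eq_two] using hS.contDiff_ham)
  simpa using this

lemma exists_lipschitz_field (hS : IsCutoffSystem H g) :
    ∃ C, LipschitzWith C (hamiltonianField H) :=
  hS.contDiff_field.lipschitzWith_of_hasCompactSupport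
    (hasCompactSupport_hamiltonianField hS.compact_ham) one_ne_zero

lemma exists_bound_pert (hS : IsCutoffSystem H g) : ∃ B : ℝ≥0, ∀ u x ε, ‖g u x ε‖ ≤ B := by
  obtain ⟨B, hB⟩ := hS.compact_pert.exists_bound_of_continuous hS.contDiff_pert.continuous
  exact ⟨B.toNNReal, fun u x ε => (hB (u, x, ε)).trans (Real.le_coe_toNNReal B)⟩

lemma continuous_perturbedField (hS : IsCutoffSystem H g) (ε : ℝ) :
    Continuous (Function.uncurry (perturbedField H g ε)) := by
  have h1 : Continuous fun z : ℝ × Plane => hamiltonianField H z.2 :=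
    hS.contDiff_field.continuous.comp continuous_snd
  have h2 : Continuous fun z : ℝ × Plane => g z.1 z.2 ε :=
    hS.contDiff_pert.continuous.comp
      (by fun_prop : Continuous fun z : ℝ × Plane => (z.1, z.2, ε))
  exact h1.add (h2.const_smul ε)

lemma exists_lipschitz_perturbedField (hS : IsCutoffSystem H g) (ε : ℝ) :
    ∃ C, ∀ u, LipschitzWith C (perturbedField H g ε u) := by
  obtain ⟨C, hC⟩ := hS.exists_lipschitz_field
  obtain ⟨D, hD⟩ := hS.contDiff_pert.lipschitzWith_of_hasCompactSupport hS.compact_pert one_ne_zero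
  refine ⟨C + ‖ε‖₊ * D, fun u => hC.add ?_⟩
  refine LipschitzWith.of_dist_le_mul fun x y => ?_
  have h := hD.dist_le_mul (u, x, ε) (u, y, ε)
  simp only [Prod.dist_eq, dist_self, dist_nonneg, max_eq_left, max_eq_right] at h
  rw [dist_smul₀, NNReal.coe_mul, mul_assoc]
  exact mul_le_mul_of_nonneg_left h (norm_nonneg ε)

lemma exists_bound_perturbedField (hS : IsCutoffSystem H g) (ε : ℝ) :
    ∃ B : ℝ≥0, ∀ u x, ‖perturbedField H g ε u x‖ ≤ B := by
  obtain ⟨A, hA⟩ := (hasCompactSupport_hamiltonianField hS.compact_ham).exists_bound_of_continuous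
    hS.contDiff_field.continuous
  obtain ⟨B, hB⟩ := hS.exists_bound_pert
  refine ⟨A.toNNReal + ‖ε‖₊ * B, fun u x => (norm_add_le _ _).trans ?_⟩
  rw [norm_smul, NNReal.coe_add, NNReal.coe_mul]
  exact add_le_add ((hA x).trans (Real.le_coe_toNNReal A))
    (mul_le_mul_of_nonneg_left (hB u x ε) (norm_nonneg ε))

end IsCutoffSystem

/-- Cutting off the Hamiltonian and the perturbation outside a large ball. -/
lemma exists_isCutoffSystem {H : Plane → ℝ} (hH : ContDiff ℝ 2 H) {g : ℝ → Plane → ℝ → Plane}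
    (hg : ContDiff ℝ 1 fun z : ℝ × Plane × ℝ => g z.1 z.2.1 z.2.2) {R : ℝ} (hR : 0 < R) :
    ∃ H' g', IsCutoffSystem H' g' ∧ (∀ x ∈ Metric.ball 0 R, H' x = H x) ∧
      ∀ u x ε, |u| ≤ R → ‖x‖ ≤ R → |ε| ≤ R → g' u x ε = g u x ε := by
  obtain ⟨χ, hχ, hχc, hχ1⟩ := exists_contDiff_cutoff Plane hR 2
  obtain ⟨ψ, hψ, hψc, hψ1⟩ := exists_contDiff_cutoff (ℝ × Plane × ℝ) hR 1
  have h1 : ContDiff ℝ 2 fun x => χ x * H x := by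
    have : ContDiff ℝ 2 χ := by exact_mod_cast hχ
    exact this.mul hH
  have h2 : ContDiff ℝ 1 fun z : ℝ × Plane × ℝ => ψ z • g z.1 z.2.1 z.2.2 := by
    have : ContDiff ℝ 1 ψ := by exact_mod_cast hψ
    exact this.smul hg
  have h3 : HasCompactSupport fun z : ℝ × Plane × ℝ => ψ z • g z.1 z.2.1 z.2.2 :=
    hψc.mono fun z hz h0 => hz (by simp [h0])
  refine ⟨fun x => χ x * H x, fun u x ε => ψ (u, x, ε) • g u x ε, ⟨h1, hχc.mul_right, h2, h3⟩,
    fun x hx => ?_, fun u x ε hu hx hε => ?_⟩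
  · simp [hχ1 x (by simpa using (Metric.mem_ball.1 hx).le)]
  · have : ψ (u, x, ε) = 1 := hψ1 _ (by simp [Prod.norm_def, hu, hx, hε])
    simp [this]

lemma fderiv_eq_of_eqOn_ball {H H' : Plane → ℝ} {R : ℝ} (h : ∀ x ∈ Metric.ball 0 R, H' x = H x)
    {x : Plane} (hx : x ∈ Metric.ball 0 R) : fderiv ℝ H' x = fderiv ℝ H x :=
  Filter.EventuallyEq.fderiv_eq (by
    filter_upwards [Metric.isOpen_ball.mem_nhds hx] with z hz using h z hz)

lemma hamiltonianField_eq_of_eqOn_ball {H H' : Plane → ℝ} {R : ℝ}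
    (h : ∀ x ∈ Metric.ball 0 R, H' x = H x) {x : Plane} (hx : x ∈ Metric.ball 0 R) :
    hamiltonianField H' x = hamiltonianField H x := by
  simp only [hamiltonianField, fderiv_eq_of_eqOn_ball h hx]

/-! ### Chains of solutions between impulses and their energy balance -/

/-- A solution of the impulsive system over `[t₀, t_N]`, cut into its smooth pieces: `z k` is the
state at `t k` before the impulse, and `x k` is the solution on `[t k, t (k + 1)]`, starting from
the state after the impulse at `t k`. -/
structure IsImpulsiveChain (H : Plane → ℝ) (g : ℝ → Plane → ℝ → Plane) (t : ℕ → ℝ)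
    (l : ℕ → Plane → ℝ → Plane) (ε : ℝ) (N : ℕ) (x : ℕ → ℝ → Plane) (z : ℕ → Plane) : Prop where
  arc : ∀ k < N, IsArc (perturbedField H g ε) (t k) (t (k + 1)) (x k)
  start : ∀ k < N, x k (t k) = z k + ε • l k (z k) ε
  finish : ∀ k < N, x k (t (k + 1)) = z (k + 1)

/-- The first-order energy change along `y` over `[t₀, t_N]` caused by the perturbation. -/
noncomputable def energyIntegral (H : Plane → ℝ) (g : ℝ → Plane → ℝ → Plane) (t : ℕ → ℝ)
    (l : ℕ → Plane → ℝ → Plane) (N : ℕ) (y : ℝ → Plane) : ℝ :=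
  ∑ k ∈ Finset.range N, (fderiv ℝ H (y (t k)) (l k (y (t k)) 0) +
    ∫ u in t k..t (k + 1), fderiv ℝ H (y u) (g u (y u) 0))

section Chain

variable {H : Plane → ℝ} {g : ℝ → Plane → ℝ → Plane} {t : ℕ → ℝ} {l : ℕ → Plane → ℝ → Plane}
  {N : ℕ} {ι : Type*} {lf : Filter ι} {ε : ι → ℝ} {x : ι → ℕ → ℝ → Plane} {z : ι → ℕ → Plane}
  {y : ℝ → Plane}

/-- As `ε → 0`, a solution on `[a, b]` of the perturbed system with converging initial values
converges uniformly to the unperturbed solution. -/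
lemma IsCutoffSystem.tendstoUniformlyOn (hS : IsCutoffSystem H g) (hε : Tendsto ε lf (𝓝 0))
    {a b : ℝ} {x : ι → ℝ → Plane} (hx : ∀ᶠ i in lf, IsArc (perturbedField H g (ε i)) a b (x i))
    (hy : IsArc (fun _ => hamiltonianField H) a b y)
    (hlim : Tendsto (fun i => x i a) lf (𝓝 (y a))) : TendstoUniformlyOn x y lf (Icc a b) := by
  obtain ⟨C, hC⟩ := hS.exists_lipschitz_field
  obtain ⟨B, hB⟩ := hS.exists_bound_pert
  refine tendstoUniformlyOn_of_isArc (F := fun _ => hamiltonianField H)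
    (hS.contDiff_field.continuous.comp continuous_snd) (fun _ => hC)
    (fun i => hS.continuous_perturbedField (ε i)) (η := fun i => |ε i| * B)
    (fun i => by positivity) (fun i u z => ?_) ?_ hx hy hlim
  · rw [perturbedField, dist_self_add_left, norm_smul]
    exact mul_le_mul_of_nonneg_left (hB u z _) (norm_nonneg _)
  · simpa using (hε.abs.mul_const (B : ℝ))

/-- The effect of a small impulse: `z + ε l(z, ε) → w` as `z → w`, `ε → 0`. -/
lemma tendsto_add_smul_impulse {l : Plane → ℝ → Plane}
    (hl : Continuous fun p : Plane × ℝ => l p.1 p.2) (hε : Tendsto ε lf (𝓝 0)) {z : ι → Plane}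
    {w : Plane} (hz : Tendsto z lf (𝓝 w)) :
    Tendsto (fun i => z i + ε i • l (z i) (ε i)) lf (𝓝 w) := by
  have h := (hl.tendsto (w, 0)).comp (hz.prodMk_nhds hε)
  simpa using hz.add (hε.smul h)

lemma tendsto_chain (hS : IsCutoffSystem H g) (ht : Monotone t)
    (hl : ∀ k, Continuous fun p : Plane × ℝ => l k p.1 p.2)
    (hε : Tendsto ε lf (𝓝 0))
    (hx : ∀ᶠ i in lf, IsImpulsiveChain H g t l (ε i) N (x i) (z i))
    (hy : ∀ k < N, IsArc (fun _ => hamiltonianField H) (t k) (t (k + 1)) y)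
    (hz : Tendsto (fun i => z i 0) lf (𝓝 (y (t 0)))) :
    (∀ k ≤ N, Tendsto (fun i => z i k) lf (𝓝 (y (t k)))) ∧
      ∀ k < N, TendstoUniformlyOn (fun i => x i k) y lf (Icc (t k) (t (k + 1))) := by
  have step : ∀ k < N, Tendsto (fun i => z i k) lf (𝓝 (y (t k))) →
      TendstoUniformlyOn (fun i => x i k) y lf (Icc (t k) (t (k + 1))) := by
    intro k hk hzk
    refine hS.tendstoUniformlyOn hε (hx.mono fun i hi => hi.arc k hk) (hy k hk) ?_
    refine (tendsto_add_smul_impulse (hl k) hε hzk).congr' ?_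
    filter_upwards [hx] with i hi using (hi.start k hk).symm
  have hzs : ∀ k ≤ N, Tendsto (fun i => z i k) lf (𝓝 (y (t k))) := by
    intro k
    induction k with
    | zero => exact fun _ => hz
    | succ k ih =>
      intro hk
      have h := (step k hk (ih (Nat.le_of_lt hk))).tendsto_at
        (right_mem_Icc.2 (ht (Nat.le_succ k)))
      refine h.congr' ?_
      filter_upwards [hx] with i hi using hi.finish k hk
  exact ⟨hzs, fun k hk => step k hk (hzs k hk.le)⟩

/-- Energy change at a small impulse. -/
lemma tendsto_energy_impulse (hH : ContDiff ℝ 2 H) {l : Plane → ℝ → Plane}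
    (hl : Continuous fun p : Plane × ℝ => l p.1 p.2) (hε : Tendsto ε lf (𝓝 0))
    (hε0 : ∀ᶠ i in lf, ε i ≠ 0) {z : ι → Plane} {w : Plane} (hz : Tendsto z lf (𝓝 w)) :
    Tendsto (fun i => (H (z i + ε i • l (z i) (ε i)) - H (z i)) / ε i) lf
      (𝓝 (fderiv ℝ H w (l w 0))) := by
  have hl' : Tendsto (fun i => l (z i) (ε i)) lf (𝓝 (l w 0)) :=
    (hl.tendsto (w, 0)).comp (hz.prodMk_nhds hε)
  have hs : HasStrictFDerivAt H (fderiv ℝ H w) w :=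
    hH.contDiffAt.hasStrictFDerivAt (by norm_num)
  have ho := hs.isLittleO.comp_tendsto
    ((tendsto_add_smul_impulse hl hε hz).prodMk_nhds hz)
  have hO : (fun i => ε i • l (z i) (ε i)) =O[lf] ε := by
    simpa using (Asymptotics.isBigO_refl ε lf).smul (hl'.isBigO_one ℝ)
  have ho' : (fun i => H (z i + ε i • l (z i) (ε i)) - H (z i) -
      fderiv ℝ H w (ε i • l (z i) (ε i))) =o[lf] ε := by
    refine Asymptotics.IsLittleO.trans_isBigO ?_ hO
    simpa [Function.comp_def] using ho
  have hmain := ho'.tendsto_div_nhds_zero.add (((fderiv ℝ H w).continuous.tendsto _).comp hl')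
  rw [zero_add] at hmain
  refine hmain.congr' ?_
  filter_upwards [hε0] with i hi
  simp only [Function.comp, map_smul, smul_eq_mul]
  field_simp
  ring

lemma IsArc.energy_eq (hS : IsCutoffSystem H g) {e : ℝ} {a b : ℝ} (hab : a ≤ b) {x : ℝ → Plane}
    (hx : IsArc (perturbedField H g e) a b x) :
    H (x b) - H (x a) = e * ∫ u in a..b, fderiv ℝ H (x u) (g u (x u) e) := by
  have hd : Differentiable ℝ H := hS.contDiff_ham.differentiable (by norm_num)
  have hcont : ContinuousOn (fun u => fderiv ℝ H (x u) (g u (x u) e)) (Icc a b) := by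
    have h1 : ContinuousOn (fun u => fderiv ℝ H (x u)) (Icc a b) :=
      (hS.contDiff_ham.continuous_fderiv (by norm_num)).comp_continuousOn hx.continuousOn
    have h2 : ContinuousOn (fun u => g u (x u) e) (Icc a b) :=
      hS.contDiff_pert.continuous.comp_continuousOn
        (continuousOn_id.prodMk (hx.continuousOn.prodMk continuousOn_const))
    exact h1.clm_apply h2
  rw [← intervalIntegral.integral_const_mul]
  refine (intervalIntegral.integral_eq_sub_of_hasDerivAt_of_le (f := fun u => H (x u)) hab
    (hd.continuous.comp_continuousOn hx.continuousOn) (fun u hu => ?_) ?_).symm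
  · have h := (hd (x u)).hasFDerivAt.comp_hasDerivAt u (hx.hasDerivAt u hu)
    simpa [perturbedField, fderiv_hamiltonianField, Function.comp_def] using h
  · refine ContinuousOn.intervalIntegrable ?_
    rw [uIcc_of_le hab]
    exact continuousOn_const.mul hcont

/-- The energy changes along the chain by `ε (energyIntegral + o(1))`. -/
lemma tendsto_energy_chain [lf.IsCountablyGenerated] (hS : IsCutoffSystem H g) (ht : Monotone t)
    (hl : ∀ k, Continuous fun p : Plane × ℝ => l k p.1 p.2)
    (hε : Tendsto ε lf (𝓝 0)) (hε0 : ∀ᶠ i in lf, ε i ≠ 0)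
    (hx : ∀ᶠ i in lf, IsImpulsiveChain H g t l (ε i) N (x i) (z i))
    (hy : ∀ k < N, IsArc (fun _ => hamiltonianField H) (t k) (t (k + 1)) y)
    (hz : Tendsto (fun i => z i 0) lf (𝓝 (y (t 0)))) :
    Tendsto (fun i => (H (z i N) - H (z i 0)) / ε i) lf (𝓝 (energyIntegral H g t l N y)) := by
  obtain ⟨hzs, hxs⟩ := tendsto_chain hS ht hl hε hx hy hz
  have hsum : Tendsto (fun i => ∑ k ∈ Finset.range N,
      ((H (z i k + ε i • l k (z i k) (ε i)) - H (z i k)) / ε i +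
        ∫ u in t k..t (k + 1), fderiv ℝ H (x i k u) (g u (x i k u) (ε i)))) lf
      (𝓝 (energyIntegral H g t l N y)) := by
    refine tendsto_finsetSum _ fun k hk => ?_
    have hk := Finset.mem_range.1 hk
    refine (tendsto_energy_impulse hS.contDiff_ham (hl k) hε hε0 (hzs k hk.le)).add ?_
    have hkt := ht (Nat.le_succ k)
    obtain ⟨A, hA⟩ := (hS.compact_ham.fderiv ℝ).exists_bound_of_continuous
      (hS.contDiff_ham.continuous_fderiv (by norm_num))
    obtain ⟨B, hB⟩ := hS.exists_bound_pert
    have hDH : Continuous (fderiv ℝ H) := hS.contDiff_ham.continuous_fderiv (by norm_num)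
    refine intervalIntegral.tendsto_integral_filter_of_dominated_convergence (fun _ => A * B)
      ?_ ?_ intervalIntegrable_const ?_
    · filter_upwards [hx] with i hi
      have hc := (hi.arc k hk).continuousOn
      have h1 : ContinuousOn (fun u => fderiv ℝ H (x i k u)) (Icc (t k) (t (k + 1))) :=
        hDH.comp_continuousOn hc
      have h2 : ContinuousOn (fun u => g u (x i k u) (ε i)) (Icc (t k) (t (k + 1))) :=
        hS.contDiff_pert.continuous.comp_continuousOn
          (continuousOn_id.prodMk (hc.prodMk continuousOn_const))
      rw [uIoc_of_le hkt]
      exact ((h1.clm_apply h2).mono Ioc_subset_Icc_self).aestronglyMeasurable measurableSet_Ioc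
    · refine Eventually.of_forall fun i => Eventually.of_forall fun u _ => ?_
      refine (ContinuousLinearMap.le_opNorm _ _).trans ?_
      exact mul_le_mul (hA _) (hB _ _ _) (norm_nonneg _) ((norm_nonneg _).trans (hA 0))
    · refine Eventually.of_forall fun u hu => ?_
      rw [uIoc_of_le hkt] at hu
      have hxu := (hxs k hk).tendsto_at (Ioc_subset_Icc_self hu)
      have h1 : Tendsto (fun i => fderiv ℝ H (x i k u)) lf (𝓝 (fderiv ℝ H (y u))) :=
        (hDH.tendsto (y u)).comp hxu
      have h2 : Tendsto (fun i => g u (x i k u) (ε i)) lf (𝓝 (g u (y u) 0)) :=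
        (hS.contDiff_pert.continuous.tendsto (u, y u, 0)).comp
          (tendsto_const_nhds.prodMk_nhds (hxu.prodMk_nhds hε))
      exact (isBoundedBilinearMap_apply.continuous.tendsto
        (fderiv ℝ H (y u), g u (y u) 0)).comp (h1.prodMk_nhds h2)
  refine hsum.congr' ?_
  filter_upwards [hε0, hx] with i hi hxi
  rw [← Finset.sum_range_sub (fun k => H (z i k)) N, Finset.sum_div]
  refine Finset.sum_congr rfl fun k hk => ?_
  have hk := Finset.mem_range.1 hk
  have he := (hxi.arc k hk).energy_eq hS (ht (Nat.le_succ k))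
  rw [hxi.start k hk, hxi.finish k hk] at he
  have : H (z i (k + 1)) - H (z i k) =
      (H (z i k + ε i • l k (z i k) (ε i)) - H (z i k)) +
      (H (z i (k + 1)) - H (z i k + ε i • l k (z i k) (ε i))) := by ring
  rw [this, he, add_div, mul_div_cancel_left₀ _ hi]

/-- The cut-off impulsive system has solutions with arbitrary initial value. -/
lemma exists_isImpulsiveChain (hS : IsCutoffSystem H g) (ht : Monotone t)
    (l : ℕ → Plane → ℝ → Plane) (e : ℝ) (N : ℕ) (w : Plane) :
    ∃ x z, z 0 = w ∧ IsImpulsiveChain H g t l e N x z := by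
  obtain ⟨C, hC⟩ := hS.exists_lipschitz_perturbedField e
  obtain ⟨B, hB⟩ := hS.exists_bound_perturbedField e
  choose Φ hΦ0 hΦ using fun (k : ℕ) (w : Plane) =>
    exists_isArc (hS.continuous_perturbedField e) hC hB (ht (Nat.le_succ k)) w
  let z : ℕ → Plane := fun k => Nat.rec w (fun k w => Φ k (w + e • l k w e) (t (k + 1))) k
  exact ⟨fun k => Φ k (z k + e • l k (z k) e), z, rfl, fun k _ => hΦ k _, fun k _ => hΦ0 k _,
    fun k _ => rfl⟩

/-- For fixed `ε`, the state before the last impulse depends continuously on the initial state. -/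
lemma tendsto_chain_end (hS : IsCutoffSystem H g) (ht : Monotone t) {e : ℝ}
    (hl : ∀ k, Continuous fun p => l k p e)
    (hx : ∀ i, IsImpulsiveChain H g t l e N (x i) (z i)) {x₀ : ℕ → ℝ → Plane} {z₀ : ℕ → Plane}
    (hx₀ : IsImpulsiveChain H g t l e N x₀ z₀) (hz : Tendsto (fun i => z i 0) lf (𝓝 (z₀ 0))) :
    Tendsto (fun i => z i N) lf (𝓝 (z₀ N)) := by
  obtain ⟨C, hC⟩ := hS.exists_lipschitz_perturbedField e
  have : ∀ k ≤ N, Tendsto (fun i => z i k) lf (𝓝 (z₀ k)) := by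
    intro k
    induction k with
    | zero => exact fun _ => hz
    | succ k ih =>
      intro hk
      have hzk := ih (Nat.le_of_lt hk)
      have hstart : Tendsto (fun i => x i k (t k)) lf (𝓝 (x₀ k (t k))) := by
        simp only [(hx _).start k hk, hx₀.start k hk]
        exact hzk.add ((((hl k).tendsto _).comp hzk).const_smul e)
      have h := (tendstoUniformlyOn_of_isArc (hS.continuous_perturbedField e) hC
        (F' := fun _ => perturbedField H g e) (η := fun _ : ι => 0)
        (fun _ => hS.continuous_perturbedField e) (fun _ => le_rfl)
        (fun _ _ _ => (dist_self _).le) tendsto_const_nhds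
        (Eventually.of_forall fun i => (hx i).arc k hk) (hx₀.arc k hk) hstart).tendsto_at
          (right_mem_Icc.2 (ht (Nat.le_succ k)))
      simpa only [(hx _).finish k hk, hx₀.finish k hk] using h
  exact this N le_rfl

end Chain

/-! ### The Melnikov function on a resonant orbit -/

/-- The sum of an `N`-periodic function over `N` consecutive integers does not depend on where the
window starts. -/
lemma sum_Ico_eq_of_periodic {B : ℤ → ℝ} {N : ℕ} (hB : ∀ k, B (k + N) = B k) (j : ℤ) :
    ∑ k ∈ Finset.Ico j (j + N), B k = ∑ k ∈ Finset.range N, B k := by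
  have hshift : ∀ j : ℤ, ∑ k ∈ Finset.Ico j (j + N), B k = ∑ i ∈ Finset.range N, B (j + i) := by
    intro j
    refine (Finset.sum_bij (fun (i : ℕ) _ => j + (i : ℤ)) ?_ ?_ ?_ ?_).symm
    · intro i hi
      have := Finset.mem_range.1 hi
      simp [this]
    · intro a _ b _ h
      simpa using h
    · intro k hk
      have := Finset.mem_Ico.1 hk
      exact ⟨(k - j).toNat, Finset.mem_range.2 (by omega), by omega⟩
    · intro i _
      rfl
  have hstep : ∀ j : ℤ, ∑ i ∈ Finset.range N, B (j + 1 + i) = ∑ i ∈ Finset.range N, B (j + i) := by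
    intro j
    have h1 := Finset.sum_range_succ (fun i : ℕ => B (j + i)) N
    have h2 := Finset.sum_range_succ' (fun i : ℕ => B (j + i)) N
    have h3 : ∀ i : ℕ, B (j + 1 + i) = B (j + (i + 1 : ℕ)) := fun i => by congr 1; push_cast; ring
    simp only [h3]
    rw [hB j] at h1
    simp only [Nat.cast_zero, add_zero] at h2
    linarith
  rw [hshift]
  induction j using Int.induction_on with
  | zero => simp
  | succ i ih => rw [hstep, ih]
  | pred i ih => rw [← ih, ← hstep (-(i : ℤ) - 1)]; simp

section Impulses

variable {t : ℤ → ℝ} {T : ℝ} {a m : ℕ}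

lemma impulse_time_add_mul (htT : ∀ k, t (k + a) = t k + T) (m : ℕ) (k : ℤ) :
    t (k + (m * a : ℕ)) = t k + m * T := by
  induction m with
  | zero => simp
  | succ m ih =>
    have : k + ((m + 1) * a : ℕ) = (k + (m * a : ℕ)) + a := by push_cast; ring
    rw [this, htT, ih]; push_cast; ring

/-- A half-open time window whose length is a period of the impulse times contains the impulses of
`N` consecutive indices. -/
lemma exists_impulse_window (ht : StrictMono t) (htop : Tendsto t atTop atTop)
    (hbot : Tendsto t atBot atBot) {N : ℕ} {L : ℝ} (htL : ∀ k, t (k + N) = t k + L) (τ : ℝ) :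
    ∃ j : ℤ, {k : ℤ | τ ≤ t k ∧ t k < τ + L} = ↑(Finset.Ico j (j + N)) := by
  obtain ⟨k₁, hk₁⟩ := (htop.eventually_ge_atTop τ).exists
  obtain ⟨k₀, hk₀⟩ := (hbot.eventually_lt_atBot τ).exists
  obtain ⟨j, hj, hmin⟩ := Int.exists_least_of_bdd (P := fun k => τ ≤ t k)
    ⟨k₀, fun k hk => le_of_lt (ht.lt_iff_lt.1 (hk₀.trans_le hk))⟩ ⟨k₁, hk₁⟩
  have key : ∀ k, τ ≤ t k ↔ j ≤ k := fun k => ⟨hmin k, fun h => hj.trans (ht.monotone h)⟩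
  refine ⟨j, ?_⟩
  ext k
  have h2 : t k < τ + L ↔ k < j + N := by
    have h := htL (k - N)
    rw [sub_add_cancel] at h
    rw [← not_le, ← not_le, not_iff_not]
    have := key (k - N)
    constructor
    · intro h'
      have := this.1 (by linarith)
      linarith
    · intro h'
      have := this.2 (by linarith)
      linarith
  simp [key k, h2]

lemma finsum_impulse_window (ht : StrictMono t) (htop : Tendsto t atTop atTop)
    (hbot : Tendsto t atBot atBot) {N : ℕ} {L : ℝ} (htL : ∀ k, t (k + N) = t k + L)
    {B : ℤ → ℝ} (hB : ∀ k, B (k + N) = B k) (τ : ℝ) :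
    ∑ᶠ k ∈ {k : ℤ | τ ≤ t k ∧ t k < τ + L}, B k = ∑ k ∈ Finset.range N, B k := by
  obtain ⟨j, hj⟩ := exists_impulse_window ht htop hbot htL τ
  rw [hj]
  simp only [Finset.mem_coe]
  rw [finsum_mem_finset_eq_sum, sum_Ico_eq_of_periodic hB]

variable {H : Plane → ℝ} {g : ℝ → Plane → ℝ → Plane} {l : ℤ → Plane → ℝ → Plane}
  {q : ℝ → ℝ → Plane} {h : ℝ}

/-- On a closed orbit whose period divides `m T`, the Melnikov function is the first-order energy
change over a window that starts at the impulse time `t 0`. -/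
lemma melnikov_eq_energyIntegral (hH : ContDiff ℝ 2 H)
    (hg : Continuous fun z : ℝ × Plane × ℝ => g z.1 z.2.1 z.2.2)
    (ht : StrictMono t) (htop : Tendsto t atTop atTop) (hbot : Tendsto t atBot atBot)
    (htT : ∀ k, t (k + a) = t k + T) (hlT : ∀ k, l (k + a) = l k)
    (hgT : ∀ u x ε, g (u + T) x ε = g u x ε)
    (hqc : Continuous fun u => q u h) (hqT : ∀ u, q (u + m * T) h = q u h) (τ : ℝ) :
    melnikov H g t l q T m τ h =
      energyIntegral H g (fun k => t k) (fun k => l k) (m * a) (fun u => q (u - τ) h) := by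
  have htN := impulse_time_add_mul htT m
  have hlN : ∀ k, l (k + (m * a : ℕ)) = l k := by
    have h : Function.Periodic l (a : ℤ) := hlT
    intro k
    simpa using h.nat_mul m k
  have hgN : ∀ u x ε, g (u + m * T) x ε = g u x ε := by
    have h : Function.Periodic g T := fun u => by ext1 x; ext1 ε; exact hgT u x ε
    intro u x ε
    exact congrFun (congrFun (h.nat_mul m u) x) ε
  have hqN : ∀ u, q (u + m * T - τ) h = q (u - τ) h := fun u => by
    rw [← hqT (u - τ)]; congr 1; ring
  set A : ℝ → ℝ := fun s => fderiv ℝ H (q (s - τ) h) (g s (q (s - τ) h) 0) with hA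
  have hAper : Function.Periodic A (m * T) := fun s => by simp only [hA, hqN, hgN]
  have hAc : Continuous A := by
    have h0 : Continuous fun s => q (s - τ) h := hqc.comp (by fun_prop : Continuous fun s => s - τ)
    have h1 : Continuous fun s => fderiv ℝ H (q (s - τ) h) :=
      (hH.continuous_fderiv (by norm_num)).comp h0
    exact h1.clm_apply (hg.comp (continuous_id.prodMk (h0.prodMk continuous_const)))
  have hBper : ∀ k : ℤ, (fun k : ℤ => fderiv ℝ H (q (t k - τ) h) (l k (q (t k - τ) h) 0))
      (k + (m * a : ℕ)) = (fun k : ℤ => fderiv ℝ H (q (t k - τ) h) (l k (q (t k - τ) h) 0)) k := by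
    intro k
    simp only [htN, hqN, hlN]
  rw [melnikov, finsum_impulse_window ht htop hbot htN hBper τ, energyIntegral,
    Finset.sum_add_distrib, add_comm]
  congr 1
  have ht0 : t 0 + m * T = t (m * a : ℕ) := by simpa using (htN 0).symm
  rw [hAper.intervalIntegral_add_eq τ (t 0), ht0]
  have := intervalIntegral.sum_integral_adjacent_intervals (f := A) (a := fun k : ℕ => t k)
    (n := m * a) (μ := MeasureTheory.volume) fun k _ => hAc.intervalIntegrable _ _
  simpa using this.symm

/-- The Melnikov function on a closed orbit is `T`-periodic. -/
lemma melnikov_periodic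
    (ht : StrictMono t) (htop : Tendsto t atTop atTop) (hbot : Tendsto t atBot atBot)
    (htT : ∀ k, t (k + a) = t k + T) (hlT : ∀ k, l (k + a) = l k)
    (hgT : ∀ u x ε, g (u + T) x ε = g u x ε) :
    Function.Periodic (fun τ => melnikov H g t l q T m τ h) T := by
  intro τ
  have hsub : ∀ u, u + T - (τ + T) = u - τ := fun u => by ring
  simp only [melnikov]
  congr 1
  · have := intervalIntegral.integral_comp_add_right (a := τ) (b := τ + m * T)
      (fun s => fderiv ℝ H (q (s - (τ + T)) h) (g s (q (s - (τ + T)) h) 0)) T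
    simp only [hsub, hgT] at this
    rw [this]
    congr 1
    ring
  · obtain ⟨j, hj⟩ := exists_impulse_window ht htop hbot (impulse_time_add_mul htT m) τ
    have hset : {k : ℤ | τ + T ≤ t k ∧ t k < τ + T + m * T} =
        ↑(Finset.Ico (j + a) (j + (m * a : ℕ) + a)) := by
      ext k
      have h1 : k - a ∈ {k : ℤ | τ ≤ t k ∧ t k < τ + m * T} ↔
          k - a ∈ (↑(Finset.Ico j (j + (m * a : ℕ))) : Set ℤ) := by rw [hj]
      have h2 := htT (k - a)
      rw [sub_add_cancel] at h2
      simp only [mem_ofPred_eq, Finset.coe_Ico, mem_Ico] at h1 ⊢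
      rw [h2]
      constructor
      · intro h'
        have := h1.1 ⟨by linarith, by linarith⟩
        omega
      · intro h'
        have := h1.2 (by omega)
        exact ⟨by linarith, by linarith⟩
    rw [hset, hj]
    simp only [Finset.mem_coe]
    rw [finsum_mem_finset_eq_sum, finsum_mem_finset_eq_sum, ← Finset.sum_Ico_add']
    simp only [htT, hsub, hlT]

end Impulses

/-! ### Necessity: the energy balance in the limit -/

lemma hasDerivAt_orbit_shift {H : Plane → ℝ} {V : Set ℝ} {q : ℝ → ℝ → Plane} {per : ℝ → ℝ} {r : ℕ}
    (hq : IsPeriodicFamily r H V q per) {h : ℝ} (hh : h ∈ V) (σ u : ℝ) :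
    HasDerivAt (fun u => q (u - σ) h) (hamiltonianField H (q (u - σ) h)) u :=
  (hq.ode h hh (u - σ)).comp_sub_const u σ

/-- A translate of an orbit of the family contained in a ball solves the system cut off outside
that ball. -/
lemma isArc_orbit {H H' : Plane → ℝ} {V : Set ℝ} {q : ℝ → ℝ → Plane} {per : ℝ → ℝ} {r : ℕ}
    (hq : IsPeriodicFamily r H V q per) {R : ℝ} (hH' : ∀ x ∈ Metric.ball 0 R, H' x = H x)
    {h : ℝ} (hh : h ∈ V) {σ a b : ℝ} (hR : ∀ u ∈ Icc a b, q (u - σ) h ∈ Metric.ball 0 R) :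
    IsArc (fun _ => hamiltonianField H') a b (fun u => q (u - σ) h) where
  continuousOn u _ := (hasDerivAt_orbit_shift hq hh σ u).continuousAt.continuousWithinAt
  hasDerivAt u hu := by
    rw [hamiltonianField_eq_of_eqOn_ball hH' (hR u (Ioo_subset_Icc_self hu))]
    exact hasDerivAt_orbit_shift hq hh σ u

/-- The first-order energy change along a curve in a ball is not affected by a cut-off outside
that ball. -/
lemma energyIntegral_congr {H H' : Plane → ℝ} {g g' : ℝ → Plane → ℝ → Plane} {R : ℝ} (hR : 0 < R)
    (hH' : ∀ x ∈ Metric.ball 0 R, H' x = H x)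
    (hg' : ∀ u x ε, |u| ≤ R → ‖x‖ ≤ R → |ε| ≤ R → g' u x ε = g u x ε)
    {t : ℕ → ℝ} (ht : Monotone t) (l : ℕ → Plane → ℝ → Plane) {N : ℕ}
    (htR : ∀ u ∈ Icc (t 0) (t N), |u| ≤ R) {y : ℝ → Plane}
    (hy : ∀ u ∈ Icc (t 0) (t N), y u ∈ Metric.ball 0 R) :
    energyIntegral H' g' t l N y = energyIntegral H g t l N y := by
  refine Finset.sum_congr rfl fun k hk => ?_
  have hk := Finset.mem_range.1 hk
  have hsub : Icc (t k) (t (k + 1)) ⊆ Icc (t 0) (t N) := Icc_subset_Icc (ht k.zero_le) (ht hk)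
  have htk := ht k.le_succ
  congr 1
  · rw [fderiv_eq_of_eqOn_ball hH' (hy _ (hsub (left_mem_Icc.2 htk)))]
  · refine intervalIntegral.integral_congr fun u hu => ?_
    rw [uIcc_of_le htk] at hu
    have hyu := hy u (hsub hu)
    simp only [fderiv_eq_of_eqOn_ball hH' hyu]
    rw [hg' _ _ _ (htR u (hsub hu)) (by simpa using (Metric.mem_ball.1 hyu).le)
      (by simpa using hR.le)]

section Pieces

variable {H : Plane → ℝ} {g : ℝ → Plane → ℝ → Plane} {t : ℤ → ℝ} {l : ℤ → Plane → ℝ → Plane}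
  {ε : ℝ} {x : ℝ → Plane}

/-- Cutting a solution of the impulsive system at the impulse times: on each closed piece, the
value at the left endpoint is replaced by the right limit. -/
lemma IsImpulsiveSolution.isArc (ht : StrictMono t) (hx : IsImpulsiveSolution H g t l ε x) (k : ℤ) :
    IsArc (perturbedField H g ε) (t k) (t (k + 1))
      (Function.update x (t k) (x (t k) + ε • l k (x (t k)) ε)) := by
  have hlt : t k < t (k + 1) := ht (by omega)
  have hder : ∀ u ∈ Ioo (t k) (t (k + 1)), HasDerivAt x (perturbedField H g ε u (x u)) u := by
    intro u hu
    refine hx.ode u ?_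
    rintro ⟨j, rfl⟩
    have h1 := ht.lt_iff_lt.1 hu.1
    have h2 := ht.lt_iff_lt.1 hu.2
    omega
  constructor
  · intro u hu
    rcases hu.1.eq_or_lt with rfl | hku
    · have h : Tendsto x (𝓝[>] (t k)) (𝓝 (x (t k) + ε • l k (x (t k)) ε)) := hx.jump k
      have hc : ContinuousWithinAt (Function.update x (t k) (x (t k) + ε • l k (x (t k)) ε))
          (Ici (t k)) (t k) := by
        rw [continuousWithinAt_update_same]
        rwa [Ici_sdiff_left]
      exact hc.mono Icc_subset_Ici_self
    · have hxu : ContinuousWithinAt x (Icc (t k) (t (k + 1))) u := by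
        rcases hu.2.eq_or_lt with rfl | hku'
        · have : ContinuousWithinAt x (Iic (t (k + 1))) (t (k + 1)) :=
            continuousWithinAt_Iio_iff_Iic.1 (hx.left_cont (k + 1))
          exact this.mono Icc_subset_Iic_self
        · exact (hder u ⟨hku, hku'⟩).continuousAt.continuousWithinAt
      exact (continuousWithinAt_update_of_ne hku.ne').2 hxu
  · intro u hu
    rw [Function.update_of_ne hu.1.ne']
    refine (hder u hu).congr_of_eventuallyEq ?_
    filter_upwards [isOpen_ne.mem_nhds hu.1.ne'] with w hw using Function.update_of_ne hw _ _

/-- A global solution of the impulsive system whose values stay in a ball gives a chain for the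
system cut off outside that ball. -/
lemma IsImpulsiveSolution.isImpulsiveChain (ht : StrictMono t)
    (hx : IsImpulsiveSolution H g t l ε x) {H' : Plane → ℝ} {g' : ℝ → Plane → ℝ → Plane} {R : ℝ}
    (hH' : ∀ x ∈ Metric.ball 0 R, H' x = H x)
    (hg' : ∀ u x ε, |u| ≤ R → ‖x‖ ≤ R → |ε| ≤ R → g' u x ε = g u x ε) {N : ℕ}
    (htR : ∀ u ∈ Icc (t 0) (t N), |u| ≤ R) (hxR : ∀ u, x u ∈ Metric.ball 0 R) (hε : |ε| ≤ R) :
    IsImpulsiveChain H' g' (fun k => t k) (fun k => l k) ε N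
      (fun k => Function.update x (t k) (x (t k) + ε • l k (x (t k)) ε)) (fun k => x (t k)) where
  arc k hk := by
    have h := hx.isArc ht k
    refine ⟨by simpa using h.continuousOn, fun u hu => ?_⟩
    have hu' : u ∈ Ioo (t k) (t (k + 1)) := by simpa using hu
    have hd := h.hasDerivAt u hu'
    have hmem : u ∈ Icc (t 0) (t N) :=
      ⟨(ht.monotone (by omega)).trans hu'.1.le, hu'.2.le.trans (ht.monotone (by omega))⟩
    have hne : u ≠ t k := hu'.1.ne'
    rw [Function.update_of_ne hne] at hd ⊢
    have hxu := hxR u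
    rwa [perturbedField, hamiltonianField_eq_of_eqOn_ball hH' hxu,
      hg' _ _ _ (htR u hmem) (by simpa using (Metric.mem_ball.1 hxu).le) hε]
  start k _ := by simp
  finish k _ := by
    have : t (k + 1) ≠ t k := (ht (by omega : (k : ℤ) < k + 1)).ne'
    simp [Function.update_of_ne this]

end Pieces

lemma IsPeriodicFamily.continuous {H : Plane → ℝ} {V : Set ℝ} {q : ℝ → ℝ → Plane} {per : ℝ → ℝ}
    {r : ℕ} (hq : IsPeriodicFamily r H V q per) {h : ℝ} (hh : h ∈ V) :
    Continuous fun u => q u h :=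
  continuous_iff_continuousAt.2 fun u => (hq.ode h hh u).continuousAt

lemma IsPeriodicFamily.isCompact_closedOrbit {H : Plane → ℝ} {V : Set ℝ} {q : ℝ → ℝ → Plane}
    {per : ℝ → ℝ} {r : ℕ} (hq : IsPeriodicFamily r H V q per) {h : ℝ} (hh : h ∈ V) :
    IsCompact (closedOrbit q h) :=
  (hq.periodic h hh).compact_of_continuous (hq.per_pos h hh).ne' (hq.continuous hh)

/-- If a closed orbit generates subharmonic solutions, the energy balance of these solutions passes
to the limit: the first-order energy change vanishes along a translate of the orbit. -/
lemma exists_energyIntegral_eq_zero {r : ℕ} {H : Plane → ℝ} (hH : ContDiff ℝ 2 H) {V : Set ℝ}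
    {q : ℝ → ℝ → Plane} {per : ℝ → ℝ} (hq : IsPeriodicFamily r H V q per)
    {g : ℝ → Plane → ℝ → Plane}
    (hg : ContDiff ℝ 1 fun z : ℝ × Plane × ℝ => g z.1 z.2.1 z.2.2)
    {t : ℤ → ℝ} (ht : StrictMono t) {l : ℤ → Plane → ℝ → Plane}
    (hl : ∀ k, Continuous fun z : Plane × ℝ => l k z.1 z.2) {T : ℝ} {m N : ℕ}
    (htN : t N = t 0 + m * T) {h : ℝ} (hh : h ∈ V)
    (hgen : GeneratesSubharmonic H g t l T m (closedOrbit q h)) :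
    ∃ σ, energyIntegral H g (fun k => t k) (fun k => l k) N (fun u => q (u - σ) h) = 0 := by
  have hL := hq.isCompact_closedOrbit hh
  have hLne : (closedOrbit q h).Nonempty := range_nonempty _
  have htm : Monotone fun k : ℕ => t k := fun i j hij => ht.monotone (by exact_mod_cast hij)
  obtain ⟨R₀, hR₀⟩ := hL.isBounded.subset_ball (0 : Plane)
  set R := |R₀| + |t 0| + |t N| + 2 with hRdef
  have hRpos : 0 < R := by positivity
  have htR : ∀ u ∈ Icc (t 0) (t N), |u| ≤ R := fun u hu => by
    have := abs_le_max_abs_abs hu.1 hu.2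
    have := max_le_add_of_nonneg (abs_nonneg (t 0)) (abs_nonneg (t N))
    have := abs_nonneg R₀
    linarith
  have hyR : ∀ u, q u h ∈ Metric.ball 0 R := fun u => by
    have := Metric.mem_ball.1 (hR₀ (mem_range_self u : q u h ∈ closedOrbit q h))
    have := le_abs_self R₀
    exact Metric.mem_ball.2 (by linarith [abs_nonneg (t 0), abs_nonneg (t N)])
  obtain ⟨H', g', hS, hH', hg'⟩ := exists_isCutoffSystem hH hg hRpos
  choose e x he0 he hx hdist using fun j : ℕ => hgen (1 / ((j : ℝ) + 1)) (by positivity)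
  have hlim0 : Tendsto (fun j : ℕ => 1 / ((j : ℝ) + 1)) atTop (𝓝 0) :=
    tendsto_one_div_add_atTop_nhds_zero_nat
  have hle1 : ∀ j : ℕ, 1 / ((j : ℝ) + 1) ≤ 1 := fun j => by
    rw [div_le_one (by positivity)]
    linarith [(Nat.cast_nonneg j : (0 : ℝ) ≤ j)]
  have hxR : ∀ j u, x j u ∈ Metric.ball 0 R := fun j u => by
    obtain ⟨w, hw, hxw⟩ := (Metric.infDist_lt_iff hLne).1 (hdist j u)
    have h1 := Metric.mem_ball.1 (hR₀ hw)
    have h2 := dist_triangle (x j u) w 0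
    have := le_abs_self R₀
    exact Metric.mem_ball.2 (by linarith [abs_nonneg (t 0), abs_nonneg (t N), hle1 j])
  -- the initial values accumulate at a point of the orbit
  obtain ⟨w, -, φ, hφ, hw⟩ := (isCompact_closedBall (0 : Plane) R).tendsto_subseq
    fun j => Metric.ball_subset_closedBall (hxR j (t 0))
  have hwL : w ∈ closedOrbit q h := by
    rw [hL.isClosed.mem_iff_infDist_zero hLne]
    refine le_antisymm ?_ Metric.infDist_nonneg
    exact le_of_tendsto_of_tendsto' (((Metric.continuous_infDist_pt _).tendsto w).comp hw)
      (hlim0.comp hφ.tendsto_atTop) fun j => (hdist (φ j) (t 0)).le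
  obtain ⟨θ, rfl⟩ := hwL
  refine ⟨t 0 - θ, ?_⟩
  have heR : ∀ j, |e j| ≤ R := fun j => by
    linarith [he j, hle1 j, abs_nonneg R₀, abs_nonneg (t 0), abs_nonneg (t N)]
  have heφ : Tendsto (fun j => e (φ j)) atTop (𝓝 0) := by
    rw [tendsto_zero_iff_abs_tendsto_zero]
    exact squeeze_zero (fun _ => abs_nonneg _) (fun j => (he (φ j)).le)
      (hlim0.comp hφ.tendsto_atTop)
  have hmain := tendsto_energy_chain (lf := atTop) (ε := fun j => e (φ j)) (l := fun k => l k)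
    (N := N) (y := fun u => q (u - (t 0 - θ)) h) (z := fun j k => x (φ j) (t k)) hS htm
    (fun k => hl k) heφ
    (Eventually.of_forall fun j => abs_pos.1 (he0 (φ j)))
    (Eventually.of_forall fun j => (hx (φ j)).solution.isImpulsiveChain ht hH' hg' htR
      (hxR (φ j)) (heR (φ j)))
    (fun k _ => isArc_orbit hq hH' hh fun u _ => hyR _)
    (by simpa [Function.comp_def] using hw)
  have hzero : ∀ j, (H' (x (φ j) (t N)) - H' (x (φ j) (t (0 : ℕ)))) / e (φ j) = 0 := fun j => by
    have := (hx (φ j)).periodic (t 0)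
    rw [htN, this]
    simp
  simp only [hzero] at hmain
  rw [← energyIntegral_congr hRpos hH' hg' htm (fun k => l k) (N := N) (by simpa using htR)
    (fun u _ => hyR _)]
  exact tendsto_nhds_unique hmain tendsto_const_nhds

/-! ### Gluing smooth pieces to periodic solutions -/

section Gluing

variable {H : Plane → ℝ} {g : ℝ → Plane → ℝ → Plane} {t : ℤ → ℝ} {l : ℤ → Plane → ℝ → Plane}
  {ε : ℝ}

/-- The half-open intervals between consecutive impulse times cover the line. -/
lemma exists_mem_Ioc_impulse (htop : Tendsto t atTop atTop)
    (hbot : Tendsto t atBot atBot) (ht : StrictMono t) (u : ℝ) :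
    ∃ k : ℤ, u ∈ Ioc (t k) (t (k + 1)) := by
  obtain ⟨k₁, hk₁⟩ := (htop.eventually_ge_atTop u).exists
  obtain ⟨k₀, hk₀⟩ := (hbot.eventually_lt_atBot u).exists
  obtain ⟨k, hk, hmax⟩ := Int.exists_greatest_of_bdd (P := fun k => t k < u)
    ⟨k₁, fun k hk => le_of_lt (ht.lt_iff_lt.1 (lt_of_lt_of_le hk hk₁))⟩ ⟨k₀, hk₀⟩
  refine ⟨k, hk, ?_⟩
  by_contra! h
  have := hmax _ h
  omega

lemma eq_of_mem_Ioc_impulse (ht : StrictMono t) {u : ℝ} {j k : ℤ}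
    (hj : u ∈ Ioc (t j) (t (j + 1))) (hk : u ∈ Ioc (t k) (t (k + 1))) : j = k := by
  have h1 := ht.lt_iff_lt.1 (hj.1.trans_le hk.2)
  have h2 := ht.lt_iff_lt.1 (hk.1.trans_le hj.2)
  omega

/-- Smooth pieces related by the impulses form a solution of the impulsive system. -/
lemma exists_isImpulsiveSolution_of_arcs (ht : StrictMono t) (htop : Tendsto t atTop atTop)
    (hbot : Tendsto t atBot atBot) {Y : ℤ → ℝ → Plane}
    (hY : ∀ k, IsArc (perturbedField H g ε) (t k) (t (k + 1)) (Y k))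
    (hglue : ∀ k, Y (k + 1) (t (k + 1)) =
      Y k (t (k + 1)) + ε • l (k + 1) (Y k (t (k + 1))) ε) :
    ∃ x, IsImpulsiveSolution H g t l ε x ∧ ∀ k, EqOn x (Y k) (Ioc (t k) (t (k + 1))) := by
  choose κ hκ using exists_mem_Ioc_impulse htop hbot ht
  have heq : ∀ k, EqOn (fun u => Y (κ u) u) (Y k) (Ioc (t k) (t (k + 1))) := fun k u hu => by
    simp only [eq_of_mem_Ioc_impulse ht (hκ u) hu]
  have hlt : ∀ k, t k < t (k + 1) := fun k => ht (by omega)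
  refine ⟨fun u => Y (κ u) u, ⟨fun u hu => ?_, fun k => ?_, fun k => ?_⟩, heq⟩
  · have hmem : u ∈ Ioo (t (κ u)) (t (κ u + 1)) :=
      ⟨(hκ u).1, (hκ u).2.lt_of_ne fun h => hu ⟨_, h.symm⟩⟩
    refine ((hY (κ u)).hasDerivAt u hmem).congr_of_eventuallyEq ?_
    filter_upwards [isOpen_Ioo.mem_nhds hmem] with w hw using heq _ (Ioo_subset_Ioc_self hw)
  · obtain ⟨k, rfl⟩ : ∃ j, k = j + 1 := ⟨k - 1, by ring⟩
    have hval : Y (κ (t (k + 1))) (t (k + 1)) = Y k (t (k + 1)) :=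
      heq k (right_mem_Ioc.2 (hlt k))
    rw [hval]
    have hc := ((hY k).continuousOn (t (k + 1)) (right_mem_Icc.2 (hlt k).le)).mono
      Ioo_subset_Icc_self
    rw [ContinuousWithinAt, nhdsWithin_Ioo_eq_nhdsLT (hlt k)] at hc
    refine hc.congr' ?_
    filter_upwards [Ioo_mem_nhdsLT (hlt k)] with w hw using (heq k (Ioo_subset_Ioc_self hw)).symm
  · obtain ⟨k, rfl⟩ : ∃ j, k = j + 1 := ⟨k - 1, by ring⟩
    have hval : Y (κ (t (k + 1))) (t (k + 1)) = Y k (t (k + 1)) :=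
      heq k (right_mem_Ioc.2 (hlt k))
    rw [hval, ← hglue k]
    have hc := ((hY (k + 1)).continuousOn (t (k + 1)) (left_mem_Icc.2 (hlt _).le)).mono
      Ioo_subset_Icc_self
    rw [ContinuousWithinAt, nhdsWithin_Ioo_eq_nhdsGT (hlt _)] at hc
    refine hc.congr' ?_
    filter_upwards [Ioo_mem_nhdsGT (hlt (k + 1))] with w hw using
      (heq _ (Ioo_subset_Ioc_self hw)).symm

/-- A chain over a period of the system that returns to its initial state extends to a periodic
solution on the line. -/
lemma IsImpulsiveChain.exists_periodic (ht : StrictMono t) (htop : Tendsto t atTop atTop)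
    (hbot : Tendsto t atBot atBot) {N : ℕ} (hN : 0 < N) {L : ℝ}
    (htL : ∀ k, t (k + N) = t k + L) (hlL : ∀ k, l (k + N) = l k)
    (hgL : ∀ u x ε, g (u + L) x ε = g u x ε) {X : ℕ → ℝ → Plane} {z : ℕ → Plane}
    (hX : IsImpulsiveChain H g (fun k => t k) (fun k => l k) ε N X z) (hz : z N = z 0) :
    ∃ x, IsImpulsiveSolution H g t l ε x ∧ Function.Periodic x L ∧
      ∀ k < N, EqOn x (X k) (Ioc (t k) (t (k + 1))) := by
  have hN' : (0 : ℤ) < N := by exact_mod_cast hN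
  have hNr : (N : ℝ) ≠ 0 := by positivity
  -- shifts by arbitrary multiples of the period
  have htd : ∀ d k : ℤ, t (k + d * N) = t k + d * L := by
    have h : Function.Periodic (fun k : ℤ => t k - k * (L / N)) (N : ℤ) := fun k => by
      simp only [htL]
      push_cast
      field_simp
      ring
    intro d k
    have := h.int_mul d k
    simp only [Int.cast_add, Int.cast_mul, Int.cast_natCast, Int.cast_id] at this
    have h2 : (d : ℝ) * N * (L / N) = d * L := by field_simp
    linarith
  have hld : ∀ d k : ℤ, l (k + d * N) = l k := by
    have h : Function.Periodic l (N : ℤ) := hlL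
    intro d k
    simpa using h.int_mul d k
  have hgd : ∀ (d : ℤ) u x, g (u - d * L) x ε = g u x ε := by
    have h : Function.Periodic g L := fun u => by ext1 x; ext1 ε; exact hgL u x ε
    intro d u x
    exact congrFun (congrFun (h.sub_int_mul_eq d) x) ε
  -- every index is `i + d * N` with `0 ≤ i < N`
  have hidx : ∀ k : ℤ, ∃ (i : ℕ) (d : ℤ), i < N ∧ k = i + d * N := by
    intro k
    have h1 := Int.emod_nonneg k hN'.ne'
    have h2 := Int.emod_lt_of_pos k hN'
    refine ⟨(k % N).toNat, k / N, by omega, ?_⟩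
    rw [Int.toNat_of_nonneg h1]
    have := Int.emod_add_mul_ediv k N
    linarith [mul_comm (k / N) (N : ℤ)]
  have hmod : ∀ (i : ℕ) (d : ℤ), i < N →
      ((i + d * N : ℤ) % N).toNat = i ∧ (i + d * N : ℤ) / N = d := by
    intro i d hi
    have hi' : (i : ℤ) < N := by exact_mod_cast hi
    have h0 : (0 : ℤ) ≤ i := by positivity
    constructor
    · rw [Int.add_mul_emod_self_right, Int.emod_eq_of_lt h0 hi']
      simp
    · rw [Int.add_mul_ediv_right _ _ hN'.ne', Int.ediv_eq_zero_of_lt h0 hi', zero_add]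
  -- `k = i + d * N` gets the `i`-th piece of the chain, shifted by `d` periods
  set Y : ℤ → ℝ → Plane := fun k u => X (k % N).toNat (u - (k / N : ℤ) * L) with hYdef
  have hYeq : ∀ (i : ℕ) (d : ℤ), i < N → Y (i + d * N) = fun u => X i (u - d * L) := by
    intro i d hi
    simp only [hYdef, (hmod i d hi).1, (hmod i d hi).2]
  have harc : ∀ k, IsArc (perturbedField H g ε) (t k) (t (k + 1)) (Y k) := by
    intro k
    obtain ⟨i, d, hi, rfl⟩ := hidx k
    have h := hX.arc i hi
    have e1 : t (i + d * N + 1) = t ((i + 1 : ℕ) : ℤ) + d * L := by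
      rw [← htd]; congr 1; push_cast; ring
    rw [hYeq i d hi, htd, e1]
    constructor
    · refine h.continuousOn.comp (by fun_prop) fun u hu => ?_
      exact ⟨by linarith [hu.1], by linarith [hu.2]⟩
    · intro u hu
      have := (h.hasDerivAt (u - d * L) ⟨by linarith [hu.1], by linarith [hu.2]⟩).comp_sub_const
        u (d * L)
      simpa only [perturbedField, hgd] using this
  have hglue : ∀ k, Y (k + 1) (t (k + 1)) =
      Y k (t (k + 1)) + ε • l (k + 1) (Y k (t (k + 1))) ε := by
    intro k
    obtain ⟨i, d, hi, rfl⟩ := hidx k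
    have e1 : t (i + d * N + 1) = t ((i + 1 : ℕ) : ℤ) + d * L := by
      rw [← htd]; congr 1; push_cast; ring
    have e2 : l (i + d * N + 1) = l ((i + 1 : ℕ) : ℤ) := by
      rw [← hld d ((i + 1 : ℕ) : ℤ)]; congr 1; push_cast; ring
    have e3 : Y (i + d * N) (t (i + d * N + 1)) = z (i + 1) := by
      rw [hYeq i d hi, e1]
      simpa using hX.finish i hi
    rw [e3, e2]
    rcases Nat.lt_or_ge (i + 1) N with hlt | hge
    · have e4 : (i + d * N + 1 : ℤ) = ((i + 1 : ℕ) : ℤ) + d * N := by push_cast; ring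
      rw [e1, e4, hYeq (i + 1) d hlt]
      simpa using hX.start (i + 1) hlt
    · -- the last piece is followed by the first piece of the next period
      obtain rfl : i + 1 = N := by omega
      have e4 : (i + d * (i + 1 : ℕ) + 1 : ℤ) = ((0 : ℕ) : ℤ) + (d + 1) * (i + 1 : ℕ) := by
        push_cast; ring
      have e5 : l ((i + 1 : ℕ) : ℤ) = l ((0 : ℕ) : ℤ) := by simpa using hlL 0
      rw [e4, hYeq 0 (d + 1) hN, htd, hz, e5]
      simpa using hX.start 0 hN
  obtain ⟨x, hx, hxY⟩ := exists_isImpulsiveSolution_of_arcs ht htop hbot harc hglue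
  refine ⟨x, hx, fun u => ?_, fun k hk u hu => ?_⟩
  · obtain ⟨k, hk⟩ := exists_mem_Ioc_impulse htop hbot ht u
    rw [hxY k hk]
    have e1 : t (k + N + 1) = t (k + 1) + L := by
      rw [← htL]; congr 1; ring
    have hmem : u + L ∈ Ioc (t (k + N)) (t (k + N + 1)) := by
      rw [htL, e1]
      exact ⟨by linarith [hk.1], by linarith [hk.2]⟩
    rw [hxY (k + N) hmem]
    obtain ⟨i, d, hi, rfl⟩ := hidx k
    have e2 : (i + d * N + N : ℤ) = i + (d + 1) * N := by ring
    rw [e2, hYeq i (d + 1) hi, hYeq i d hi]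
    simp only [Int.cast_add, Int.cast_one]
    congr 1
    ring
  · rw [hxY k hu]
    have := hYeq k 0 hk
    simp only [zero_mul, add_zero, Int.cast_zero, sub_zero] at this
    rw [this]

end Gluing

/-! ### Energy and phase near a closed orbit -/

/-- In the plane, `DH(x)` and the Hamiltonian field are related by a quarter turn. -/
lemma sq_fderiv_add_sq_inner_hamiltonianField (H : Plane → ℝ) (x ξ : Plane) :
    (fderiv ℝ H x ξ) ^ 2 + ⟪hamiltonianField H x, ξ⟫ ^ 2 =
      ‖hamiltonianField H x‖ ^ 2 * ‖ξ‖ ^ 2 := by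
  have hξ : ξ = ξ 0 • EuclideanSpace.single (0 : Fin 2) (1 : ℝ) +
      ξ 1 • EuclideanSpace.single (1 : Fin 2) (1 : ℝ) := by
    ext i
    fin_cases i <;> simp
  have h1 : fderiv ℝ H x ξ = ξ 0 * fderiv ℝ H x (EuclideanSpace.single 0 1) +
      ξ 1 * fderiv ℝ H x (EuclideanSpace.single 1 1) := by
    conv_lhs => rw [hξ]
    simp only [map_add, map_smul, smul_eq_mul]
  have h2 : ⟪hamiltonianField H x, ξ⟫ = ξ 0 * fderiv ℝ H x (EuclideanSpace.single 1 1) -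
      ξ 1 * fderiv ℝ H x (EuclideanSpace.single 0 1) := by
    simp [PiLp.inner_apply, hamiltonianField, Fin.sum_univ_two]
    ring
  rw [h1, h2, EuclideanSpace.real_norm_sq_eq, EuclideanSpace.real_norm_sq_eq]
  simp only [Fin.sum_univ_two, hamiltonianField, PiLp.toLp_apply, Matrix.cons_val_zero,
    Matrix.cons_val_one]
  ring

/-- Near a point that is not an equilibrium, a point is determined by its energy and by its
component in the direction of the flow. -/
lemma exists_nhds_eq_of_energy_of_phase {H : Plane → ℝ} (hH : ContDiff ℝ 2 H) {w : Plane}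
    (hw : hamiltonianField H w ≠ 0) :
    ∃ U ∈ 𝓝 w, ∀ x ∈ U, ∀ y ∈ U, H x = H y →
      ⟪hamiltonianField H w, x⟫ = ⟪hamiltonianField H w, y⟫ → x = y := by
  set v := hamiltonianField H w with hv
  have hvpos : 0 < ‖v‖ := norm_pos_iff.2 hw
  have hs : HasStrictFDerivAt H (fderiv ℝ H w) w := hH.contDiffAt.hasStrictFDerivAt (by norm_num)
  have hbound := hs.isLittleO.bound (half_pos hvpos)
  rw [nhds_prod_eq, eventually_prod_self_iff'] at hbound
  obtain ⟨U, hU, hUb⟩ := hbound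
  refine ⟨U, hU, fun x hx y hy hxy hin => ?_⟩
  have h1 := hUb x hx y hy
  have h2 := sq_fderiv_add_sq_inner_hamiltonianField H w (x - y)
  rw [← hv, inner_sub_right, hin, sub_self, zero_pow two_ne_zero, add_zero, ← mul_pow] at h2
  have h3 := abs_eq_abs.2 (sq_eq_sq_iff_eq_or_eq_neg.1 h2)
  rw [abs_of_nonneg (by positivity : 0 ≤ ‖v‖ * ‖x - y‖)] at h3
  simp only [hxy, sub_self, zero_sub, norm_neg, Real.norm_eq_abs, h3] at h1
  have h4 : ‖x - y‖ ≤ 0 := by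
    by_contra! hpos
    nlinarith [mul_pos hvpos hpos]
  exact sub_eq_zero.1 (norm_le_zero_iff.1 h4)

section Family

variable {H : Plane → ℝ} {V : Set ℝ} {q : ℝ → ℝ → Plane} {per : ℝ → ℝ} {r : ℕ}

lemma IsPeriodicFamily.continuousAt (hq : IsPeriodicFamily r H V q per) (hV : IsOpen V) {h : ℝ}
    (hh : h ∈ V) (s : ℝ) : ContinuousAt (fun z : ℝ × ℝ => q z.1 z.2) (s, h) :=
  hq.contDiffOn.continuousOn.continuousAt ((isOpen_univ.prod hV).mem_nhds ⟨mem_univ s, hh⟩)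

/-- There are no equilibria on the closed orbits: `DH` is nonzero there, as `H (q s h) = h`. -/
lemma IsPeriodicFamily.hamiltonianField_ne_zero (hq : IsPeriodicFamily r H V q per) (hr : 1 ≤ r)
    (hH : Differentiable ℝ H) (hV : IsOpen V) {h : ℝ} (hh : h ∈ V) (s : ℝ) :
    hamiltonianField H (q s h) ≠ 0 := by
  intro h0
  have hfd : ∀ ξ, fderiv ℝ H (q s h) ξ = 0 := fun ξ => by
    have := sq_fderiv_add_sq_inner_hamiltonianField H (q s h) ξ
    rw [h0] at this
    simpa using this
  have hqd : DifferentiableAt ℝ (fun z : ℝ × ℝ => q z.1 z.2) (s, h) :=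
    (hq.contDiffOn.contDiffAt ((isOpen_univ.prod hV).mem_nhds ⟨mem_univ s, hh⟩)).differentiableAt
      (by exact_mod_cast (by omega : r ≠ 0))
  have hqh : DifferentiableAt ℝ (fun h => q s h) h :=
    DifferentiableAt.comp (g := fun z : ℝ × ℝ => q z.1 z.2) (f := fun h => (s, h)) h hqd (by fun_prop)
  have h1 := (hH (q s h)).hasFDerivAt.comp_hasDerivAt h hqh.hasDerivAt
  have h2 : HasDerivAt (H ∘ fun h => q s h) 1 h := by
    refine (hasDerivAt_id h).congr_of_eventuallyEq ?_
    filter_upwards [hV.mem_nhds hh] with h' hh' using hq.level h' hh' s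
  have := h1.unique h2
  rw [hfd] at this
  exact zero_ne_one this

/-- Near a point of a closed orbit, the component in the direction of the flow increases along the
orbits of the family. -/
lemma IsPeriodicFamily.exists_phase_lt (hq : IsPeriodicFamily r H V q per) (hr : 1 ≤ r)
    (hH : ContDiff ℝ 2 H) (hV : IsOpen V) {h₀ : ℝ} (hh₀ : h₀ ∈ V) (s₀ : ℝ) :
    ∃ ρ > 0, ∀ h, |h - h₀| < ρ → ∀ s s', |s - s₀| < ρ → |s' - s₀| < ρ → s < s' →
      ⟪hamiltonianField H (q s₀ h₀), q s h⟫ < ⟪hamiltonianField H (q s₀ h₀), q s' h⟫ := by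
  set v := hamiltonianField H (q s₀ h₀) with hv
  have hvne : v ≠ 0 := hq.hamiltonianField_ne_zero hr (hH.differentiable (by norm_num)) hV hh₀ s₀
  have hfc : Continuous (hamiltonianField H) :=
    (contDiff_hamiltonianField (n := 1) (by simpa [one_add_one_eq_two] using hH)).continuous
  have hc : ContinuousAt (fun z : ℝ × ℝ => ⟪v, hamiltonianField H (q z.1 z.2)⟫) (s₀, h₀) :=
    continuousAt_const.inner (𝕜 := ℝ) (hfc.continuousAt.comp (hq.continuousAt hV hh₀ s₀))
  have hpos : 0 < ⟪v, hamiltonianField H (q s₀ h₀)⟫ := by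
    rw [← hv, real_inner_self_eq_norm_sq]
    have := norm_pos_iff.2 hvne
    positivity
  have hev := (hc.eventually (lt_mem_nhds hpos)).and
    ((isOpen_univ.prod hV).mem_nhds (⟨mem_univ s₀, hh₀⟩ : (s₀, h₀) ∈ univ ×ˢ V))
  obtain ⟨ρ, hρ, hball⟩ := Metric.eventually_nhds_iff.1 hev
  refine ⟨ρ, hρ, fun h hh s s' hs hs' hlt => ?_⟩
  have key : ∀ u ∈ Icc s s', 0 < ⟪v, hamiltonianField H (q u h)⟫ ∧ h ∈ V := fun u hu => by
    have := hball (y := (u, h)) (by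
      rw [Prod.dist_eq, max_lt_iff, Real.dist_eq, Real.dist_eq]
      refine ⟨?_, hh⟩
      rw [abs_lt] at hs hs' ⊢
      exact ⟨by linarith [hu.1], by linarith [hu.2]⟩)
    exact ⟨this.1, this.2.2⟩
  have hhV := (key s (left_mem_Icc.2 hlt.le)).2
  have hd : ∀ u, HasDerivAt (fun u => ⟪v, q u h⟫) ⟪v, hamiltonianField H (q u h)⟫ u := fun u => by
    have := (hasDerivAt_const u v).inner ℝ (hq.ode h hhV u)
    simpa using this
  refine strictMonoOn_of_deriv_pos (convex_Icc s s')
    (fun u _ => (hd u).continuousAt.continuousWithinAt) (fun u hu => ?_)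
    (left_mem_Icc.2 hlt.le) (right_mem_Icc.2 hlt.le) hlt
  rw [(hd u).deriv]
  exact (key u (interior_subset hu)).1

/-- The period is continuous wherever the frequency is. -/
lemma continuousAt_period {per : ℝ → ℝ} {h₀ : ℝ} (hpos : 0 < per h₀)
    (hΩ : ContinuousAt (frequency per) h₀) : ContinuousAt per h₀ := by
  have h : per = fun h => 2 * Real.pi / frequency per h := by
    ext h
    rw [frequency, div_div_cancel₀ (by positivity)]
  have hne : frequency per h₀ ≠ 0 := by
    rw [frequency]; positivity
  rw [h]
  exact continuousAt_const.div hΩ hne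

end Family

/-- A function with nonzero derivative changes sign strictly. -/
lemma eventually_sign_of_hasDerivAt {F : ℝ → ℝ} {D x : ℝ} (hF : HasDerivAt F D x) (hD : D ≠ 0) :
    ∀ᶠ b in 𝓝[>] 0, 0 < D * (F (x + b) - F x) ∧ D * (F (x - b) - F x) < 0 := by
  have hlim : Tendsto (fun y => D * slope F x y) (𝓝[≠] x) (𝓝 (D * D)) :=
    hF.tendsto_slope.const_mul D
  have hev := hlim.eventually (lt_mem_nhds (mul_self_pos.2 hD))
  have h1 : Tendsto (fun b : ℝ => x + b) (𝓝[>] 0) (𝓝[≠] x) := by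
    refine tendsto_nhdsWithin_iff.2 ⟨?_, ?_⟩
    · exact ((by fun_prop : Continuous fun b : ℝ => x + b).tendsto' 0 x (by simp)).mono_left
        nhdsWithin_le_nhds
    · filter_upwards [self_mem_nhdsWithin] with b hb
      simpa using (ne_of_gt hb)
  have h2 : Tendsto (fun b : ℝ => x - b) (𝓝[>] 0) (𝓝[≠] x) := by
    refine tendsto_nhdsWithin_iff.2 ⟨?_, ?_⟩
    · exact ((by fun_prop : Continuous fun b : ℝ => x - b).tendsto' 0 x (by simp)).mono_left
        nhdsWithin_le_nhds
    · filter_upwards [self_mem_nhdsWithin] with b hb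
      simpa using (ne_of_gt hb)
  filter_upwards [h1.eventually hev, h2.eventually hev, self_mem_nhdsWithin] with b hb1 hb2 hb
  have hb : 0 < b := hb
  rw [slope_def_field] at hb1 hb2
  constructor
  · have := mul_pos hb1 hb
    rwa [add_sub_cancel_left, mul_div_assoc', div_mul_cancel₀ _ hb.ne'] at this
  · have := mul_pos hb2 hb
    have hx : x - b - x = -b := by ring
    rw [hx, div_neg, mul_neg, mul_div_assoc', neg_mul, div_mul_cancel₀ _ hb.ne'] at this
    linarith

/-- A chain for the cut-off system whose pieces stay in the ball is a chain for the original
system. -/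
lemma IsImpulsiveChain.congr {H H' : Plane → ℝ} {g g' : ℝ → Plane → ℝ → Plane} {R : ℝ}
    (hH' : ∀ x ∈ Metric.ball 0 R, H' x = H x)
    (hg' : ∀ u x ε, |u| ≤ R → ‖x‖ ≤ R → |ε| ≤ R → g' u x ε = g u x ε)
    {t : ℕ → ℝ} (ht : Monotone t) {l : ℕ → Plane → ℝ → Plane} {ε : ℝ} {N : ℕ}
    {X : ℕ → ℝ → Plane} {z : ℕ → Plane} (hX : IsImpulsiveChain H' g' t l ε N X z)
    (htR : ∀ u ∈ Icc (t 0) (t N), |u| ≤ R) (hε : |ε| ≤ R)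
    (hXR : ∀ k < N, ∀ u ∈ Icc (t k) (t (k + 1)), X k u ∈ Metric.ball 0 R) :
    IsImpulsiveChain H g t l ε N X z where
  arc k hk := by
    refine ⟨(hX.arc k hk).continuousOn, fun u hu => ?_⟩
    have hd := (hX.arc k hk).hasDerivAt u hu
    have hxu := hXR k hk u (Ioo_subset_Icc_self hu)
    have hmem : u ∈ Icc (t 0) (t N) :=
      ⟨(ht k.zero_le).trans hu.1.le, hu.2.le.trans (ht hk)⟩
    rwa [perturbedField, hamiltonianField_eq_of_eqOn_ball hH' hxu,
      hg' _ _ _ (htR u hmem) (by simpa using (Metric.mem_ball.1 hxu).le) hε] at hd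
  start := hX.start
  finish := hX.finish

/-! ### Persistence of a resonant orbit -/

/-- A uniform bound for the translates `q(· - σ, h)` on a compact interval, for `(σ, h)` near a
given parameter. -/
lemma IsPeriodicFamily.exists_bound {H : Plane → ℝ} {V : Set ℝ} {q : ℝ → ℝ → Plane} {per : ℝ → ℝ}
    {r : ℕ} (hq : IsPeriodicFamily r H V q per) (hV : IsOpen V) {h₀ : ℝ} (hh₀ : h₀ ∈ V)
    (τ a b : ℝ) :
    ∃ R₀, ∃ ρ > 0, ∀ σ h, |σ - τ| < ρ → |h - h₀| < ρ →
      h ∈ V ∧ ∀ u ∈ Icc a b, q (u - σ) h ∈ Metric.ball 0 R₀ := by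
  obtain ⟨ρ, hρ, hball⟩ := Metric.nhds_basis_closedBall.mem_iff.1 (hV.mem_nhds hh₀)
  have hsub : Icc (a - τ - ρ) (b - τ + ρ) ×ˢ Metric.closedBall h₀ ρ ⊆ univ ×ˢ V :=
    prod_mono (subset_univ _) hball
  have hK := (isCompact_Icc (a := a - τ - ρ) (b := b - τ + ρ)).prod (isCompact_closedBall h₀ ρ)
  obtain ⟨R₀, hR₀⟩ := (hK.image_of_continuousOn
    (hq.contDiffOn.continuousOn.mono hsub)).isBounded.subset_ball (0 : Plane)
  refine ⟨R₀, ρ, hρ, fun σ h hσ hh => ?_⟩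
  have hmem : h ∈ Metric.closedBall h₀ ρ := by
    rw [Metric.mem_closedBall, Real.dist_eq]; exact hh.le
  refine ⟨hball hmem, fun u hu => hR₀ ⟨(u - σ, h), ⟨?_, hmem⟩, rfl⟩⟩
  have := abs_lt.1 hσ
  exact ⟨by linarith [hu.1], by linarith [hu.2]⟩

/-- Over a time `K per(h₀)`, the phase on the orbit `h` advances by `K (per h₀ - per h)`; its sign
is that of `Ω h - Ω h₀`. -/
lemma IsPeriodicFamily.phase_sign {H : Plane → ℝ} {V : Set ℝ} {q : ℝ → ℝ → Plane} {per : ℝ → ℝ}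
    {r : ℕ} (hq : IsPeriodicFamily r H V q per) {h₀ h : ℝ} (hh₀ : h₀ ∈ V) (hh : h ∈ V) {K : ℕ}
    (hK : 1 ≤ K) {v : Plane} {s₀ s ρ : ℝ} (hs : |s - s₀| < ρ / 2)
    (hd : |K * (per h₀ - per h)| < ρ / 2)
    (hphase : ∀ s s', |s - s₀| < ρ → |s' - s₀| < ρ → s < s' → ⟪v, q s h⟫ < ⟪v, q s' h⟫)
    {c : ℝ} (hc : 0 < c * (frequency per h - frequency per h₀)) :
    0 < c * (⟪v, q (s + K * per h₀) h⟫ - ⟪v, q s h⟫) := by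
  have hp := hq.per_pos h hh
  have hp₀ := hq.per_pos h₀ hh₀
  set d := K * (per h₀ - per h) with hddef
  have hKpos : (0 : ℝ) < K := by exact_mod_cast hK
  have hcd : 0 < c * d := by
    have : c * d = c * (frequency per h - frequency per h₀) *
        (K * (per h * per h₀) / (2 * Real.pi)) := by
      have := Real.pi_pos
      rw [hddef, frequency, frequency]
      field_simp
    rw [this]
    have := Real.pi_pos
    positivity
  have hqd : q (s + K * per h₀) h = q (s + d) h := by
    have h1 : s + K * per h₀ = (s + d) + K * per h := by rw [hddef]; ring
    rw [h1]
    exact (hq.periodic h hh).nat_mul K (s + d)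
  rw [hqd]
  have hρ : 0 < ρ := by linarith [abs_nonneg (s - s₀)]
  have hs1 : |s - s₀| < ρ := by linarith
  have hs2 : |s + d - s₀| < ρ := by
    have : s + d - s₀ = (s - s₀) + d := by ring
    rw [this]
    exact (abs_add_le _ _).trans_lt (by linarith)
  rcases pos_and_pos_or_neg_and_neg_of_mul_pos hcd with ⟨hc0, hd0⟩ | ⟨hc0, hd0⟩
  · exact mul_pos hc0 (sub_pos.2 (hphase s (s + d) hs1 hs2 (by linarith)))
  · exact mul_pos_of_neg_of_neg hc0 (sub_neg.2 (hphase (s + d) s hs2 hs1 (by linarith)))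

section Persistence

variable {r : ℕ} {H : Plane → ℝ} {V : Set ℝ} {q : ℝ → ℝ → Plane} {per : ℝ → ℝ}
  {g : ℝ → Plane → ℝ → Plane} {t : ℤ → ℝ} {l : ℤ → Plane → ℝ → Plane} {N : ℕ} {L : ℝ}

/-- A chain of the impulsive system that closes up and is close to a translate of a resonant orbit
extends to a periodic solution with the same distance to that orbit on the whole line. -/
lemma IsImpulsiveChain.exists_periodic_near (ht : StrictMono t) (htop : Tendsto t atTop atTop)
    (hbot : Tendsto t atBot atBot) (hN : 0 < N) (hL : 0 < L)
    (htL : ∀ k, t (k + N) = t k + L) (hlL : ∀ k, l (k + N) = l k)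
    (hgL : ∀ u x ε, g (u + L) x ε = g u x ε) {ε : ℝ} {X : ℕ → ℝ → Plane} {z : ℕ → Plane}
    (hX : IsImpulsiveChain H g (fun k => t k) (fun k => l k) ε N X z) (hz : z N = z 0)
    {y : ℝ → Plane} (hy : Function.Periodic y L) {η : ℝ}
    (hη : ∀ k < N, ∀ u ∈ Icc (t k) (t (k + 1)), dist (y u) (X k u) < η) :
    ∃ x, IsImpulsiveSolution H g t l ε x ∧ Function.Periodic x L ∧ ∀ u, dist (y u) (x u) < η := by
  obtain ⟨x, hx, hxL, hxX⟩ := hX.exists_periodic ht htop hbot hN htL hlL hgL hz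
  refine ⟨x, hx, hxL, fun u => ?_⟩
  have hper : Function.Periodic (fun u => dist (y u) (x u)) L := fun u => by
    simp only [hy u, hxL u]
  obtain ⟨w, hw, hwu⟩ := hper.exists_mem_Ioc hL u (t 0)
  rw [hwu]
  obtain ⟨k, hk⟩ := exists_mem_Ioc_impulse htop hbot ht w
  have htN : t N = t 0 + L := by simpa using htL 0
  have h1 : k < N := ht.lt_iff_lt.1 (hk.1.trans_le (htN ▸ hw.2))
  have h2 : 0 < k + 1 := ht.lt_iff_lt.1 (hw.1.trans_le hk.2)
  lift k to ℕ using by omega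
  have hkN : k < N := by exact_mod_cast h1
  rw [hxX k hkN hk]
  exact hη k hkN w (Ioc_subset_Icc_self hk)

/-- **Persistence of a resonant orbit.** At a translate `τ` at which the first-order energy change
vanishes with nonzero derivative, periodic solutions close to the translate of the orbit exist for
all small `ε`.

The unknown is the initial state `q(t₀ - σ, h)`, with `(σ, h)` in a small rectangle around
`(τ, h₀)`. The energy difference over a period, divided by `ε`, has opposite signs on the sides
`σ = τ ± a`, and the phase difference has opposite signs on the sides `h = h₀ ± b`, so both vanish
somewhere. As the impulses are merely continuous in `ε`, only `C⁰` convergence is available for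
these functions, and the implicit function theorem does not apply. -/
theorem eventually_exists_periodic_near (hr : 1 ≤ r) (hH : ContDiff ℝ 2 H) (hV : IsOpen V)
    (hq : IsPeriodicFamily r H V q per)
    (hg : ContDiff ℝ 1 fun z : ℝ × Plane × ℝ => g z.1 z.2.1 z.2.2)
    (ht : StrictMono t) (htop : Tendsto t atTop atTop) (hbot : Tendsto t atBot atBot)
    (hl : ∀ k, Continuous fun z : Plane × ℝ => l k z.1 z.2) (hN : 0 < N) (hL : 0 < L)
    (htL : ∀ k, t (k + N) = t k + L) (hlL : ∀ k, l (k + N) = l k)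
    (hgL : ∀ u x ε, g (u + L) x ε = g u x ε) {h₀ : ℝ} (hh₀ : h₀ ∈ V) {K : ℕ} (hK : 1 ≤ K)
    (hLK : L = K * per h₀) {τ M' : ℝ}
    (hM : energyIntegral H g (fun k => t k) (fun k => l k) N (fun u => q (u - τ) h₀) = 0)
    (hMd : HasDerivAt
      (fun σ => energyIntegral H g (fun k => t k) (fun k => l k) N (fun u => q (u - σ) h₀)) M' τ)
    (hM' : M' ≠ 0) (hΩ : deriv (frequency per) h₀ ≠ 0) {η : ℝ} (hη : 0 < η) :
    ∀ᶠ ε in 𝓝[≠] 0, ∃ x, IsImpulsiveSolution H g t l ε x ∧ Function.Periodic x L ∧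
      ∀ u, dist (q (u - τ) h₀) (x u) < η := by
  have htm : Monotone fun k : ℕ => t k := fun i j hij => ht.monotone (by exact_mod_cast hij)
  have htN : t N = t 0 + L := by simpa using htL 0
  have hsubI : ∀ k < N, Icc (t k) (t (k + 1)) ⊆ Icc (t 0) (t N) := fun k hk =>
    Icc_subset_Icc (ht.monotone (by omega)) (ht.monotone (by omega))
  -- cut off outside a large ball
  obtain ⟨R₀, ρ₀, hρ₀, hbox⟩ := hq.exists_bound hV hh₀ τ (t 0) (t N)
  set R := |R₀| + |t 0| + |t N| + 1 with hRdef
  have hRpos : 0 < R := by positivity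
  have htR : ∀ u ∈ Icc (t 0) (t N), |u| ≤ R := fun u hu => by
    have := abs_le_max_abs_abs hu.1 hu.2
    have := max_le_add_of_nonneg (abs_nonneg (t 0)) (abs_nonneg (t N))
    have := abs_nonneg R₀
    linarith
  have hR₀R : R₀ + 1 ≤ R := by
    have := le_abs_self R₀; have := abs_nonneg (t 0); have := abs_nonneg (t N); linarith
  have hqR : ∀ σ h, |σ - τ| < ρ₀ → |h - h₀| < ρ₀ → ∀ u ∈ Icc (t 0) (t N),
      q (u - σ) h ∈ Metric.ball 0 R := fun σ h hσ hh u hu =>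
    Metric.ball_subset_ball (by linarith) ((hbox σ h hσ hh).2 u hu)
  obtain ⟨H', g', hS, hH', hg'⟩ := exists_isCutoffSystem hH hg hRpos
  choose X Z hZ0 hXZ using fun (e : ℝ) (w : Plane) =>
    exists_isImpulsiveChain hS htm (fun k : ℕ => l k) e N w
  set w : ℝ × ℝ → Plane := fun p => q (t 0 - p.1) p.2 with hw
  have hwc : ∀ p : ℝ × ℝ, p.2 ∈ V → ContinuousAt w p := fun p hp =>
    (hq.continuousAt hV hp (t 0 - p.1)).comp (f := fun p : ℝ × ℝ => (t 0 - p.1, p.2)) (by fun_prop)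
  have hyarc : ∀ σ h, |σ - τ| < ρ₀ → |h - h₀| < ρ₀ → ∀ k < N,
      IsArc (fun _ => hamiltonianField H') (t (k : ℕ)) (t ((k + 1 : ℕ) : ℤ))
        (fun u => q (u - σ) h) := fun σ h hσ hh k hk =>
    isArc_orbit hq hH' (hbox σ h hσ hh).1 fun u hu =>
      hqR σ h hσ hh u (hsubI k hk (by simpa using hu))
  set w₀ := q (t 0 - τ) h₀ with hw₀
  set v := hamiltonianField H w₀ with hv
  have hvne : v ≠ 0 := hq.hamiltonianField_ne_zero hr (hH.differentiable (by norm_num)) hV hh₀ _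
  have hτ₀ : |τ - τ| < ρ₀ := by simpa using hρ₀
  have hh₀₀ : |h₀ - h₀| < ρ₀ := by simpa using hρ₀
  have ht0N : t 0 ≤ t N := by linarith
  have hvH' : hamiltonianField H' w₀ = v :=
    hamiltonianField_eq_of_eqOn_ball hH' (hqR τ h₀ hτ₀ hh₀₀ _ (left_mem_Icc.2 ht0N))
  obtain ⟨U, hU, hUinj⟩ := exists_nhds_eq_of_energy_of_phase hS.contDiff_ham (w := w₀)
    (by rwa [hvH'])
  rw [hvH'] at hUinj
  obtain ⟨ρ₁, hρ₁, hphase⟩ := hq.exists_phase_lt hr hH hV hh₀ (t 0 - τ)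
  have hyL : Function.Periodic (fun u => q (u - τ) h₀) L := fun u => by
    have h1 : u + L - τ = (u - τ) + K * per h₀ := by rw [hLK]; ring
    simp only [h1]
    exact (hq.periodic h₀ hh₀).nat_mul K (u - τ)
  -- near `(0, (τ, h₀))`, the solutions are close to the translate of the orbit
  have hnear : ∀ᶠ i in 𝓝 (0 : ℝ) ×ˢ 𝓝 ((τ, h₀) : ℝ × ℝ), (w i.2 ∈ U ∧ Z i.1 (w i.2) N ∈ U) ∧
      ∀ k ∈ Finset.range N, ∀ u ∈ Icc (t k) (t (k + 1)),
        dist (q (u - τ) h₀) (X i.1 (w i.2) k u) < min η 1 := by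
    have hwlim : Tendsto (fun i : ℝ × ℝ × ℝ => w i.2) (𝓝 (0 : ℝ) ×ˢ 𝓝 ((τ, h₀) : ℝ × ℝ))
        (𝓝 w₀) := (hwc (τ, h₀) hh₀).tendsto.comp tendsto_snd
    obtain ⟨hz, hx⟩ := tendsto_chain (ε := fun i : ℝ × ℝ × ℝ => i.1) (N := N)
      (x := fun i => X i.1 (w i.2)) (z := fun i => Z i.1 (w i.2)) (y := fun u => q (u - τ) h₀)
      hS htm (fun k : ℕ => hl k) tendsto_fst (Eventually.of_forall fun i => hXZ _ _)
      (hyarc τ h₀ hτ₀ hh₀₀) (by simpa [hZ0] using hwlim)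
    have hzN := hz N le_rfl
    have hlast : q (t N - τ) h₀ = w₀ := by rw [htN]; exact hyL (t 0)
    rw [hlast] at hzN
    refine ((hwlim.eventually hU).and (hzN.eventually hU)).and ?_
    rw [Finset.eventually_all]
    intro k hk
    have := Metric.tendstoUniformlyOn_iff.1 (hx k (Finset.mem_range.1 hk)) (min η 1)
      (lt_min hη one_pos)
    simpa using this
  obtain ⟨P₀, hP₀, Q₀, hQ₀, hPQ⟩ := eventually_prod_iff.1 hnear
  obtain ⟨ρ₂, hρ₂, hQ₂⟩ := Metric.eventually_nhds_iff.1 hQ₀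
  -- the sides on which the energy difference has a sign
  have hside₁ : ∀ σ, |σ - τ| < ρ₀ → ∀ c : ℝ,
      0 < c * energyIntegral H g (fun k => t k) (fun k => l k) N (fun u => q (u - σ) h₀) →
      ∀ᶠ i in 𝓝[≠] (0 : ℝ) ×ˢ 𝓝 h₀,
        0 < c * ((H' (Z i.1 (w (σ, i.2)) N) - H' (w (σ, i.2))) / i.1) := by
    intro σ hσ c hc
    have hε : Tendsto (fun i : ℝ × ℝ => i.1) (𝓝[≠] (0 : ℝ) ×ˢ 𝓝 h₀) (𝓝 0) :=
      tendsto_nhds_of_tendsto_nhdsWithin tendsto_fst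
    have hε0 : ∀ᶠ i in 𝓝[≠] (0 : ℝ) ×ˢ 𝓝 h₀, i.1 ≠ 0 :=
      (tendsto_fst (f := 𝓝[≠] (0 : ℝ)) (g := 𝓝 h₀)).eventually self_mem_nhdsWithin
    have hwlim : Tendsto (fun i : ℝ × ℝ => w (σ, i.2)) (𝓝[≠] (0 : ℝ) ×ˢ 𝓝 h₀)
        (𝓝 (w (σ, h₀))) :=
      (hwc (σ, h₀) hh₀).tendsto.comp (tendsto_const_nhds.prodMk_nhds tendsto_snd)
    have hlim := tendsto_energy_chain (ε := fun i : ℝ × ℝ => i.1) (N := N)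
      (x := fun i => X i.1 (w (σ, i.2))) (z := fun i => Z i.1 (w (σ, i.2)))
      (y := fun u => q (u - σ) h₀) hS htm (fun k : ℕ => hl k) hε hε0
      (Eventually.of_forall fun i => hXZ _ _) (hyarc σ h₀ hσ hh₀₀) (by simpa [hZ0] using hwlim)
    rw [energyIntegral_congr hRpos hH' hg' htm (fun k => l k) (N := N) (by simpa using htR)
      (fun u hu => hqR σ h₀ hσ hh₀₀ u (by simpa using hu))] at hlim
    simpa only [hZ0] using (hlim.const_mul c).eventually (lt_mem_nhds hc)
  -- the sides on which the phase difference has a sign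
  have hside₂ : ∀ a, a < ρ₀ → a < ρ₁ / 2 → ∀ h, |h - h₀| < ρ₀ → |h - h₀| < ρ₁ →
      |K * (per h₀ - per h)| < ρ₁ / 2 → ∀ c : ℝ,
      0 < c * (frequency per h - frequency per h₀) →
      ∀ᶠ e in 𝓝 (0 : ℝ), ∀ σ ∈ Icc (τ - a) (τ + a),
        0 < c * (⟪v, Z e (w (σ, h)) N⟫ - ⟪v, w (σ, h)⟫) := by
    intro a ha₀ ha₁ h hh0 hh1 hd c hc
    refine isCompact_Icc.eventually_forall_of_forall_eventually fun σ hσ => ?_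
    have hστ : |σ - τ| ≤ a := abs_le.2 ⟨by linarith [hσ.1], by linarith [hσ.2]⟩
    have hhV : h ∈ V := (hbox σ h (by linarith) hh0).1
    have hwlim : Tendsto (fun i : ℝ × ℝ => w (i.2, h)) (𝓝 (0, σ)) (𝓝 (w (σ, h))) :=
      (hwc (σ, h) hhV).tendsto.comp (f := fun i : ℝ × ℝ => (i.2, h))
        ((by fun_prop : Continuous fun i : ℝ × ℝ => (i.2, h)).tendsto (0, σ))
    have hzN := (tendsto_chain (ε := fun i : ℝ × ℝ => i.1) (N := N)
      (x := fun i => X i.1 (w (i.2, h))) (z := fun i => Z i.1 (w (i.2, h)))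
      (y := fun u => q (u - σ) h) hS htm (fun k : ℕ => hl k)
      (continuous_fst.tendsto ((0 : ℝ), σ)) (Eventually.of_forall fun i => hXZ _ _)
      (hyarc σ h (by linarith) hh0) (by simpa [hZ0] using hwlim)).1 N le_rfl
    have hlim := ((tendsto_const_nhds (x := v)).inner (𝕜 := ℝ) hzN).sub
      ((tendsto_const_nhds (x := v)).inner (𝕜 := ℝ) hwlim)
    refine (hlim.const_mul c).eventually (lt_mem_nhds ?_)
    have hN' : t N - σ = t 0 - σ + K * per h₀ := by rw [htN, hLK]; ring
    rw [hN']
    refine hq.phase_sign hh₀ hhV hK (s₀ := t 0 - τ) ?_ hd (hphase h hh1) hc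
    have : t 0 - σ - (t 0 - τ) = -(σ - τ) := by ring
    rw [this, abs_neg]
    linarith
  -- choice of the rectangle
  have hM0 := eventually_sign_of_hasDerivAt hMd hM'
  obtain ⟨a, ⟨ha1, ha2⟩, ha0, hamin⟩ := (hM0.and (Ioo_mem_nhdsGT
    (lt_min hρ₀ (lt_min (half_pos hρ₁) hρ₂)))).exists
  simp only [lt_min_iff] at hamin
  obtain ⟨haρ₀, haρ₁, haρ₂⟩ := hamin
  rw [hM, sub_zero] at ha1 ha2
  have hE₁ := hside₁ (τ + a) (by rwa [add_sub_cancel_left, abs_of_pos ha0]) M' ha1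
  have hE₂ := hside₁ (τ - a) (by rwa [sub_sub_cancel_left, abs_neg, abs_of_pos ha0]) (-M')
    (by linarith)
  obtain ⟨P₁, hP₁, Q₁, hQ₁, hPQ₁⟩ := eventually_prod_iff.1 (hE₁.and hE₂)
  obtain ⟨ρ₃, hρ₃, hQ₃⟩ := Metric.eventually_nhds_iff.1 hQ₁
  have hΩd : HasDerivAt (frequency per) (deriv (frequency per) h₀) h₀ :=
    (differentiableAt_of_deriv_ne_zero hΩ).hasDerivAt
  have hperc := continuousAt_period (hq.per_pos h₀ hh₀) hΩd.continuousAt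
  have hperlim : Tendsto (fun h => |K * (per h₀ - per h)|) (𝓝 h₀) (𝓝 0) := by
    have : ContinuousAt (fun h => |K * (per h₀ - per h)|) h₀ :=
      (continuousAt_const.mul (continuousAt_const.sub hperc)).abs
    simpa [ContinuousAt] using this
  obtain ⟨ρ₄, hρ₄, hper₄⟩ := Metric.eventually_nhds_iff.1
    (hperlim.eventually (gt_mem_nhds (half_pos hρ₁)))
  set D := deriv (frequency per) h₀ with hD
  obtain ⟨b, ⟨hb1, hb2⟩, hb0, hbmin⟩ := ((eventually_sign_of_hasDerivAt hΩd hΩ).and (Ioo_mem_nhdsGT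
    (lt_min hρ₀ (lt_min hρ₁ (lt_min hρ₂ (lt_min hρ₃ hρ₄)))))).exists
  simp only [lt_min_iff] at hbmin
  obtain ⟨hbρ₀, hbρ₁, hbρ₂, hbρ₃, hbρ₄⟩ := hbmin
  have habs₁ : |h₀ + b - h₀| = b := by rw [add_sub_cancel_left, abs_of_pos hb0]
  have habs₂ : |h₀ - b - h₀| = b := by rw [sub_sub_cancel_left, abs_neg, abs_of_pos hb0]
  have hF₁ := hside₂ a haρ₀ haρ₁ (h₀ + b) (by rwa [habs₁]) (by rwa [habs₁])
    (hper₄ (by rwa [Real.dist_eq, habs₁])) D hb1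
  have hF₂ := hside₂ a haρ₀ haρ₁ (h₀ - b) (by rwa [habs₂]) (by rwa [habs₂])
    (hper₄ (by rwa [Real.dist_eq, habs₂])) (-D) (by linarith)
  -- the rectangle contains the initial state of a closed solution
  filter_upwards [nhdsWithin_le_nhds hP₀, hP₁, nhdsWithin_le_nhds hF₁, nhdsWithin_le_nhds hF₂,
    nhdsWithin_le_nhds (Metric.ball_mem_nhds (0 : ℝ) hRpos), self_mem_nhdsWithin]
    with e heP₀ heP₁ heF₁ heF₂ heR he0
  have he0 : e ≠ 0 := he0
  have hrect : ∀ p ∈ Icc (τ - a) (τ + a) ×ˢ Icc (h₀ - b) (h₀ + b), |p.1 - τ| ≤ a ∧ |p.2 - h₀| ≤ b :=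
    fun p hp => ⟨abs_le.2 ⟨by linarith [hp.1.1], by linarith [hp.1.2]⟩,
      abs_le.2 ⟨by linarith [hp.2.1], by linarith [hp.2.2]⟩⟩
  have hVrect : ∀ p ∈ Icc (τ - a) (τ + a) ×ˢ Icc (h₀ - b) (h₀ + b), p.2 ∈ V := fun p hp =>
    (hbox p.1 p.2 (by linarith [(hrect p hp).1]) (by linarith [(hrect p hp).2])).1
  have hwcont : ContinuousOn w (Icc (τ - a) (τ + a) ×ˢ Icc (h₀ - b) (h₀ + b)) := fun p hp =>
    (hwc p (hVrect p hp)).continuousWithinAt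
  have hZcont : ContinuousOn (fun p => Z e (w p) N)
      (Icc (τ - a) (τ + a) ×ˢ Icc (h₀ - b) (h₀ + b)) := fun p hp =>
    tendsto_chain_end (x := fun p => X e (w p)) (z := fun p => Z e (w p))
      (l := fun k : ℕ => l k) (e := e) hS htm
      (fun k : ℕ => (hl k).comp (by fun_prop : Continuous fun x : Plane => (x, e)))
      (fun p => hXZ e (w p)) (hXZ e (w p)) (by simpa only [hZ0] using (hwcont p hp).tendsto)
  have hH'c : Continuous H' := hS.contDiff_ham.continuous
  have hQ₃' : ∀ h ∈ Icc (h₀ - b) (h₀ + b), Q₁ h := fun h hh => hQ₃ (by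
    rw [Real.dist_eq]
    exact (abs_le.2 ⟨by linarith [hh.1], by linarith [hh.2]⟩ : |h - h₀| ≤ b).trans_lt hbρ₃)
  obtain ⟨p, hp, hp1, hp2⟩ := poincare_miranda (a₁ := τ - a) (a₂ := τ + a) (b₁ := h₀ - b)
    (b₂ := h₀ + b) (by linarith [ha0]) (by linarith [hb0])
    (u := fun p => M' * ((H' (Z e (w p) N) - H' (w p)) / e))
    (v := fun p => D * (⟪v, Z e (w p) N⟫ - ⟪v, w p⟫))
    (continuousOn_const.mul (((hH'c.comp_continuousOn hZcont).sub
      (hH'c.comp_continuousOn hwcont)).div_const e))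
    (continuousOn_const.mul ((ContinuousOn.inner (𝕜 := ℝ) continuousOn_const hZcont).sub
      (ContinuousOn.inner (𝕜 := ℝ) continuousOn_const hwcont)))
    (fun h hh => by linarith [(hPQ₁ heP₁ (hQ₃' h hh)).2])
    (fun h hh => (hPQ₁ heP₁ (hQ₃' h hh)).1)
    (fun σ hσ => by linarith [heF₂ σ hσ]) heF₁
  have hpQ : Q₀ p := hQ₂ (by
    rw [Prod.dist_eq, max_lt_iff, Real.dist_eq, Real.dist_eq]
    exact ⟨(hrect p hp).1.trans_lt haρ₂, (hrect p hp).2.trans_lt hbρ₂⟩)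
  obtain ⟨⟨hpU, hpZU⟩, hpX⟩ := hPQ heP₀ hpQ
  have hclose : Z e (w p) N = w p := by
    refine hUinj _ hpZU _ hpU ?_ ?_
    · simpa [hM', he0, sub_eq_zero] using hp1
    · simpa [hΩ, sub_eq_zero] using hp2
  have hXR : ∀ k < N, ∀ u ∈ Icc (t (k : ℕ)) (t ((k + 1 : ℕ) : ℤ)),
      X e (w p) k u ∈ Metric.ball 0 R := by
    intro k hk u hu
    have hu' : u ∈ Icc (t k) (t (k + 1)) := by simpa using hu
    have h1 : dist (X e (w p) k u) (q (u - τ) h₀) < 1 := by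
      rw [dist_comm]
      exact (hpX k (Finset.mem_range.2 hk) u hu').trans_le (min_le_right _ _)
    have h2 := Metric.mem_ball.1 ((hbox τ h₀ hτ₀ hh₀₀).2 u (hsubI k hk hu'))
    have h3 := dist_triangle (X e (w p) k u) (q (u - τ) h₀) 0
    exact Metric.mem_ball.2 (by linarith)
  have heR' : |e| ≤ R := by
    have := Metric.mem_ball.1 heR
    rw [Real.dist_eq, sub_zero] at this
    exact this.le
  refine ((hXZ e (w p)).congr hH' hg' htm (by simpa using htR) heR' hXR).exists_periodic_near
    ht htop hbot hN hL htL hlL hgL (by rw [hclose, hZ0]) hyL fun k hk u hu => ?_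
  exact (hpX k (Finset.mem_range.2 hk) u hu).trans_le (min_le_left _ _)

end Persistence

/-! ### Conclusion -/

/-- If, at every accuracy `η > 0`, all small `ε ≠ 0` admit an object with the property `P ε` that
is `η`-close to `y`, then these objects can be chosen to converge to `y` uniformly. -/
lemma exists_tendstoUniformly_of_forall_eventually {α β : Type*} [PseudoMetricSpace β]
    {P : ℝ → (α → β) → Prop} {y : α → β}
    (h : ∀ η > 0, ∀ᶠ ε in 𝓝[≠] (0 : ℝ), ∃ x, P ε x ∧ ∀ u, dist (y u) (x u) < η) :
    ∃ ε₀ > 0, ∃ x : ℝ → α → β, (∀ ε, 0 < |ε| → |ε| < ε₀ → P ε (x ε)) ∧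
      TendstoUniformly x y (𝓝[≠] 0) := by
  obtain ⟨ε₀, hε₀, hball⟩ := Metric.mem_nhdsWithin_iff.1 (h 1 one_pos)
  -- the accuracies available at `ε`; the choice made is optimal up to `|ε|`
  set A : ℝ → Set ℝ := fun ε => {η | 0 < η ∧ ∃ x, P ε x ∧ ∀ u, dist (y u) (x u) < η} with hA
  have hbdd : ∀ ε, BddBelow (A ε) := fun ε => ⟨0, fun η hη => hη.1.le⟩
  have hchoice : ∀ ε, ∃ x : α → β, 0 < |ε| → |ε| < ε₀ →
      P ε x ∧ ∀ u, dist (y u) (x u) < sInf (A ε) + |ε| := by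
    intro ε
    by_cases hε : 0 < |ε| ∧ |ε| < ε₀
    · have hne : (A ε).Nonempty := ⟨1, one_pos, hball
        ⟨by rw [Metric.mem_ball, Real.dist_eq, sub_zero]; exact hε.2, abs_pos.1 hε.1⟩⟩
      obtain ⟨η, ⟨-, x, hx, hxη⟩, hlt⟩ := exists_lt_of_csInf_lt hne
        (lt_add_of_pos_right (sInf (A ε)) hε.1)
      exact ⟨x, fun _ _ => ⟨hx, fun u => (hxη u).trans hlt⟩⟩
    · exact ⟨y, fun h1 h2 => absurd ⟨h1, h2⟩ hε⟩
  choose x hx using hchoice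
  refine ⟨ε₀, hε₀, x, fun ε h1 h2 => (hx ε h1 h2).1, ?_⟩
  rw [Metric.tendstoUniformly_iff]
  intro η hη
  have hsmall : ∀ δ > 0, ∀ᶠ ε in 𝓝[≠] (0 : ℝ), |ε| < δ := fun δ hδ => by
    filter_upwards [nhdsWithin_le_nhds (Metric.ball_mem_nhds (0 : ℝ) hδ)] with ε hε
    rwa [Metric.mem_ball, Real.dist_eq, sub_zero] at hε
  filter_upwards [h (η / 2) (half_pos hη), hsmall ε₀ hε₀, hsmall (η / 2) (half_pos hη),
    self_mem_nhdsWithin] with ε h1 h2 h3 h4 u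
  have h5 : sInf (A ε) ≤ η / 2 := csInf_le (hbdd ε) ⟨half_pos hη, h1⟩
  have := (hx ε (abs_pos.2 h4) h2).2 u
  linarith

theorem theorem3p1
    (r : ℕ) (hr : 3 ≤ r)
    -- the unperturbed Hamiltonian system and its family of closed orbits
    (H : Plane → ℝ) (hH : ContDiff ℝ (r + 1) H)
    (V : Set ℝ) (hVopen : IsOpen V) (hVint : V.OrdConnected)
    (q : ℝ → ℝ → Plane) (per : ℝ → ℝ) (hq : IsPeriodicFamily r H V q per)
    -- the periodic perturbation
    (g : ℝ → Plane → ℝ → Plane)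
    (hg : ContDiff ℝ r (fun z : ℝ × Plane × ℝ => g z.1 z.2.1 z.2.2))
    (T₁ : ℝ) (hT₁ : 0 < T₁) (hgper : ∀ u x ε, g (u + T₁) x ε = g u x ε)
    -- the impulses
    (t : ℤ → ℝ) (ht : StrictMono t) (htop : Tendsto t atTop atTop) (hbot : Tendsto t atBot atBot)
    (l : ℤ → Plane → ℝ → Plane)
    (hlsmooth : ∀ k ε, ContDiff ℝ r (fun x => l k x ε))
    (hlcont : ∀ k, Continuous (fun z : Plane × ℝ => l k z.1 z.2))
    (T₂ : ℝ) (hT₂ : 0 < T₂) (n : ℕ) (hn : 1 ≤ n)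
    (htper : ∀ k, t (k + n) - t k = T₂) (hlper : ∀ k, l (k + n) = l k)
    -- commensurability of the two periods, and the common period
    (p s : ℕ) (hp : 1 ≤ p) (hs : 1 ≤ s) (hps : p.Coprime s) (hratio : T₂ / T₁ = (p : ℝ) / s)
    (T : ℝ) (hT : T = p * T₁)
    -- resonance
    (h₀ : ℝ) (hh₀ : h₀ ∈ V) (m K : ℕ) (hm : 1 ≤ m) (hK : 1 ≤ K) (hmK : m.Coprime K)
    (hres : per h₀ / T = (m : ℝ) / K) :
    (GeneratesSubharmonic H g t l T m (closedOrbit q h₀) →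
      ∃ τ ∈ Icc 0 T, melnikov H g t l q T m τ h₀ = 0) ∧
    (∀ τ ∈ Icc 0 T, melnikov H g t l q T m τ h₀ = 0 →
      deriv (frequency per) h₀ ≠ 0 →
      deriv (fun σ => melnikov H g t l q T m σ h₀) τ ≠ 0 →
      ∃ ε₀ > 0, ∃ x : ℝ → ℝ → Plane,
        (∀ ε, 0 < |ε| → |ε| < ε₀ → IsSubharmonicSolution H g t l T m ε (x ε)) ∧
        TendstoUniformly x (fun u => q (u - τ) h₀) (𝓝[≠] 0)) := by
  have hH2 : ContDiff ℝ 2 H := hH.of_le (by exact_mod_cast (by omega : 2 ≤ r + 1))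
  have hg1 : ContDiff ℝ 1 fun z : ℝ × Plane × ℝ => g z.1 z.2.1 z.2.2 :=
    hg.of_le (by exact_mod_cast (by omega : 1 ≤ r))
  have hp0 : (0 : ℝ) < p := by exact_mod_cast hp
  have hs0 : (0 : ℝ) < s := by exact_mod_cast hs
  have hm0 : (0 : ℝ) < m := by exact_mod_cast hm
  have hK0 : (0 : ℝ) < K := by exact_mod_cast hK
  have hTpos : 0 < T := by rw [hT]; positivity
  have hTs : T = s * T₂ := by
    rw [div_eq_div_iff hT₁.ne' hs0.ne'] at hratio
    linarith
  have hmT : (m : ℝ) * T = K * per h₀ := by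
    rw [div_eq_div_iff hTpos.ne' hK0.ne'] at hres
    linarith
  -- the system has period `T`, which contains `s * n` impulses
  have hgT : ∀ u x ε, g (u + T) x ε = g u x ε := by
    have h : Function.Periodic g T₁ := fun u => by ext1 x; ext1 ε; exact hgper u x ε
    intro u x ε
    rw [hT]
    exact congrFun (congrFun (h.nat_mul p u) x) ε
  have htT : ∀ k, t (k + (s * n : ℕ)) = t k + T := fun k => by
    rw [hTs]
    exact impulse_time_add_mul (fun k => by linarith [htper k]) s k
  have hlT : ∀ k, l (k + (s * n : ℕ)) = l k := by
    have h : Function.Periodic l (n : ℤ) := hlper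
    intro k
    simpa using h.nat_mul s k
  have htN := impulse_time_add_mul htT m
  have hlN : ∀ k, l (k + (m * (s * n) : ℕ)) = l k := by
    have h : Function.Periodic l ((s * n : ℕ) : ℤ) := hlT
    intro k
    have := h.nat_mul m k
    push_cast at this ⊢
    exact this
  have hgN : ∀ u x ε, g (u + m * T) x ε = g u x ε := by
    have h : Function.Periodic g T := fun u => by ext1 x; ext1 ε; exact hgT u x ε
    intro u x ε
    exact congrFun (congrFun (h.nat_mul m u) x) ε
  have hqT : ∀ u, q (u + m * T) h₀ = q u h₀ := fun u => by
    rw [hmT]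
    exact (hq.periodic h₀ hh₀).nat_mul K u
  have hmel : ∀ τ, melnikov H g t l q T m τ h₀ =
      energyIntegral H g (fun k => t k) (fun k => l k) (m * (s * n)) (fun u => q (u - τ) h₀) :=
    melnikov_eq_energyIntegral hH2 hg1.continuous ht htop hbot htT hlT hgT
      (hq.continuous hh₀) hqT
  refine ⟨fun hgen => ?_, fun τ _ hτ hΩ hMd => ?_⟩
  · obtain ⟨σ, hσ⟩ := exists_energyIntegral_eq_zero hH2 hq hg1 ht hlcont
      (N := m * (s * n)) (by simpa using htN 0) hh₀ hgen
    obtain ⟨τ, hτ, heq⟩ := (melnikov_periodic (m := m) (q := q) (h := h₀) (H := H)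
      ht htop hbot htT hlT hgT).exists_mem_Ico₀ hTpos σ
    refine ⟨τ, Ico_subset_Icc_self hτ, ?_⟩
    rw [← hσ, ← hmel]
    exact heq.symm
  · have hfun : (fun σ => melnikov H g t l q T m σ h₀) = fun σ =>
        energyIntegral H g (fun k => t k) (fun k => l k) (m * (s * n)) (fun u => q (u - σ) h₀) :=
      funext hmel
    rw [hfun] at hMd
    have hderiv := (differentiableAt_of_deriv_ne_zero hMd).hasDerivAt
    refine exists_tendstoUniformly_of_forall_eventually fun η hη => ?_
    have hev := eventually_exists_periodic_near (N := m * (s * n)) (L := m * T) (by omega : 1 ≤ r)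
      hH2 hVopen hq hg1 ht htop hbot hlcont (by positivity) (by positivity) htN hlN hgN hh₀ hK
      hmT (by rw [← hmel]; exact hτ) hderiv hMd hΩ hη
    filter_upwards [hev] with ε ⟨x, hx, hxL, hxη⟩
    exact ⟨x, ⟨hx, hxL⟩, hxη⟩
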